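/- Let $q\in L^1_{\rm loc}(\mathbb R)$ be real-valued and even, and suppose that the differential expression $\tau_q(y)=-y''-qy$ on $\mathbb R$ is in the limit circle case at $+\infty$ and at $-\infty$ (i.e. for every $\lambda\in\mathbb C$ all solutions of $\tau_q(y)=\lambda y$ are square integrable near $+\infty$ and near $-\infty$). Let $\mathcal D_{\max}=\{y\in L^2(\mathbb R): y,y'\in AC_{\rm loc}(\mathbb R),\ \tau_q y\in L^2(\mathbb R)\}$, and let $A_{\max}y=\tau_q(y)$ for $y\in\mathcal D_{\max}$. Put $[f,g]_x=\overline{f(x)}g'(x)-\overline{f'(x)}g(x)$ and $[f,g]_{\pm\infty}=\lim_{x\to\pm\infty}[f,g]_x$. Let $w_1,w_2\in\mathcal D_{\max}$ be real-valued solutions of $\tau_q(y)=0$, $w_1$ odd and $w_2$ even, with $[w_1,w_2]_{-\infty}=[w_1,w_2]_{\infty}=1$, and for $f\in\mathcal D_{\max}$ put $\alpha_j(f)=[w_j,f]_{-\infty}$ and $\beta_j(f)=[w_j,f]_{\infty}$ ($j=1,2$). For $\xi,\eta\in\mathbb C$ with $|\xi|=|\eta|=1$ and $\alpha,\beta\in[0,2\pi)$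 let $\widetilde A=\widetilde A_{\xi,\eta,\alpha,\beta}$ be the restriction of $A_{\max}$ to $$\operatorname{dom}\widetilde A=\{f\in\mathcal D_{\max}:\ \alpha_1(f)\,\xi\cos\alpha-\alpha_2(f)\sin\alpha=0,\ \ \beta_1(f)\,\eta\cos\beta-\beta_2(f)\sin\beta=0\}$$ (separated boundary conditions). Let $(\mathcal Pf)(x)=f(-x)$ and $(\mathcal Tf)(x)=\overline{f(x)}$. A closed densely defined operator $H$ in $L^2(\mathbb R)$ is called $\mathcal{PT}$ symmetric if $\mathcal{PT}f\in\operatorname{dom}H$ and $\mathcal{PT}Hf=H\mathcal{PT}f$ for all $f\in\operatorname{dom}H$, and $\mathcal P$-self-adjoint if $H=\mathcal PH^*\mathcal P$ (including equality of domains). Different parameters may describe the same operator. Call the pair $(\xi,\alpha)$ normalized if $\xi\ne-1$, and $\xi=1$ whenever $\sin\alpha\cos\alpha=0$; similarly for $(\eta,\beta)$. Then: (1) Every $\widetilde A_{\xi,\eta,\alpha,\beta}$ is equal to some $\widetilde A_{\xi',\eta',\alpha',\beta'}$ with admissible parameters ($|\xi'|=|\eta'|=1$, $\alpha',\beta'\in[0,2\pi)$)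 for which $(\xi',\alpha')$ and $(\eta',\beta')$ are normalized. (2) If $(\xi,\alpha)$ and $(\eta,\beta)$ are normalized, then $\widetilde A$ is simultaneously $\mathcal{PT}$ symmetric, self-adjoint and $\mathcal P$-self-adjoint if and only if $\xi=\eta=1$ and $\alpha+\beta\equiv0\pmod\pi$. (3) For arbitrary admissible parameters, $\widetilde A$ is simultaneously $\mathcal{PT}$ symmetric, self-adjoint and $\mathcal P$-self-adjoint if and only if $\widetilde A=\widetilde A_{1,1,\alpha',\beta'}$ for some $\alpha',\beta'\in[0,2\pi)$ with $\alpha'+\beta'\equiv0\pmod\pi$. -/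

import Mathlib

open MeasureTheory Filter Topology

namespace PTQM

noncomputable section

/-- The Hilbert space `L²(ℝ)` of complex-valued functions. -/
abbrev L2 : Type := Lp ℂ 2 (volume : Measure ℝ)

/-! ### Parity, time reversal, and the three classes of operators -/

/-- The parity operator `(P f)(x) = f(-x)` on `L²(ℝ)`. -/
def parity (f : L2) : L2 :=
  Lp.compMeasurePreserving (fun x : ℝ => -x) (Measure.measurePreserving_neg volume) f

/-- The time reversal operator `(T f)(x) = conj (f x)` on `L²(ℝ)`. -/
def timeReversal (f : L2) : L2 := star f

theorem parity_ae (f : L2) : parity f =ᵐ[volume] fun x => f (-x) :=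
  Lp.coeFn_compMeasurePreserving f (Measure.measurePreserving_neg volume)

theorem timeReversal_ae (f : L2) :
    timeReversal f =ᵐ[volume] fun x => (starRingEnd ℂ) (f x) :=
  Lp.coeFn_star f

/-- `H` is closed and densely defined. -/
structure IsClosedDense (H : L2 →ₗ.[ℂ] L2) : Prop where
  closed : H.IsClosed
  dense : Dense (H.domain : Set L2)

/-- PT symmetry: for all `f ∈ dom H`, `P T f ∈ dom H` and `P T (H f) = H (P T f)`. -/
structure IsPTSymmetric (H : L2 →ₗ.[ℂ] L2) : Prop extends IsClosedDense H where
  comm : ∀ f : H.domain, ∃ h : parity (timeReversal (f : L2)) ∈ H.domain,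
    parity (timeReversal (H f)) = H ⟨parity (timeReversal (f : L2)), h⟩

/-- `P`-self-adjointness: `dom H = dom (H* P)` and `H f = P H* P f` for `f ∈ dom H`. -/
structure IsPSelfAdjoint (H : L2 →ₗ.[ℂ] L2) : Prop extends IsClosedDense H where
  mem_domain_iff : ∀ f : L2, f ∈ H.domain ↔ parity f ∈ H.adjoint.domain
  apply_eq : ∀ (f : H.domain) (h : parity (f : L2) ∈ H.adjoint.domain),
    H f = parity (H.adjoint ⟨parity (f : L2), h⟩)

/-! ### The differential expression and the maximal operator -/

/-- Absolute continuity on all compact intervals. -/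
def IsACLoc (y : ℝ → ℂ) : Prop := ∀ a b : ℝ, AbsolutelyContinuousOnInterval y a b

/-- `y` is differentiable, and `y` and `y'` are locally absolutely continuous; in particular
`y''` exists almost everywhere. -/
structure IsRegular (y : ℝ → ℂ) : Prop where
  differentiable : Differentiable ℝ y
  ac : IsACLoc y
  ac_deriv : IsACLoc (deriv y)

/-- The differential expression `τ_q y = -y'' - q y`. -/
def tau (q : ℝ → ℝ) (y : ℝ → ℂ) (x : ℝ) : ℂ := -(deriv (deriv y) x) - (q x : ℂ) * y x

/-- `y` solves `τ_q y = lam y` (in the almost everywhere sense). -/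
structure IsSolution (q : ℝ → ℝ) (lam : ℂ) (y : ℝ → ℂ) : Prop where
  regular : IsRegular y
  eqn : ∀ᵐ x : ℝ, tau q y x - lam * y x = 0

/-- `τ_q` is in the limit circle case at `+∞`. -/
def LimitCircleTop (q : ℝ → ℝ) : Prop :=
  ∀ (lam : ℂ) (y : ℝ → ℂ), IsSolution q lam y →
    ∃ a : ℝ, MemLp y 2 (volume.restrict (Set.Ioi a))

/-- `τ_q` is in the limit circle case at `-∞`. -/
def LimitCircleBot (q : ℝ → ℝ) : Prop :=
  ∀ (lam : ℂ) (y : ℝ → ℂ), IsSolution q lam y →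
    ∃ a : ℝ, MemLp y 2 (volume.restrict (Set.Iio a))

/-- The maximal domain: `y ∈ L²(ℝ)`, `y, y' ∈ AC_loc(ℝ)`, `τ_q y ∈ L²(ℝ)`. -/
structure InDmax (q : ℝ → ℝ) (y : ℝ → ℂ) : Prop where
  regular : IsRegular y
  memLp : MemLp y 2 volume
  memLp_tau : MemLp (tau q y) 2 volume

theorem IsACLoc.ae_differentiableAt {y : ℝ → ℂ} (h : IsACLoc y) :
    ∀ᵐ x : ℝ, DifferentiableAt ℝ y x := by
  refine LocallyBoundedVariationOn.ae_differentiableAt (f := y) ?_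
  intro a b _ _
  rw [Set.univ_inter]
  rcases le_total a b with hab | hab
  · rw [← Set.uIcc_of_le hab]
    exact (h a b).boundedVariationOn
  · exact (((h a a).boundedVariationOn).mono (by
      intro x hx
      have h1 : x = a := le_antisymm (hx.2.trans hab) hx.1
      simp [h1]))

theorem IsRegular.add {y z : ℝ → ℂ} (hy : IsRegular y) (hz : IsRegular z) :
    IsRegular (y + z) where
  differentiable := hy.differentiable.add hz.differentiable
  ac := fun a b => (hy.ac a b).add (hz.ac a b)
  ac_deriv := by
    have h : deriv (y + z) = deriv y + deriv z :=
      funext fun x => deriv_add (hy.differentiable x) (hz.differentiable x)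
    rw [h]
    exact fun a b => (hy.ac_deriv a b).add (hz.ac_deriv a b)

theorem IsRegular.smul {y : ℝ → ℂ} (c : ℂ) (hy : IsRegular y) : IsRegular (c • y) where
  differentiable := hy.differentiable.const_smul c
  ac := fun a b => (hy.ac a b).const_smul c
  ac_deriv := by
    have h : deriv (c • y) = fun x => c • deriv y x :=
      funext fun x => deriv_const_smul c (hy.differentiable x)
    rw [h]
    exact fun a b => (hy.ac_deriv a b).const_smul c

theorem tau_add {q : ℝ → ℝ} {y z : ℝ → ℂ} (hy : IsRegular y) (hz : IsRegular z) :
    tau q (y + z) =ᵐ[volume] tau q y + tau q z := by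
  have h : deriv (y + z) = deriv y + deriv z :=
    funext fun x => deriv_add (hy.differentiable x) (hz.differentiable x)
  filter_upwards [hy.ac_deriv.ae_differentiableAt, hz.ac_deriv.ae_differentiableAt]
    with x h1 h2
  simp only [tau, Pi.add_apply, h, deriv_add h1 h2]
  ring

theorem tau_smul {q : ℝ → ℝ} {y : ℝ → ℂ} (c : ℂ) (hy : IsRegular y) :
    tau q (c • y) =ᵐ[volume] c • tau q y := by
  have h : deriv (c • y) = c • deriv y :=
    funext fun x => deriv_const_smul c (hy.differentiable x)
  filter_upwards [hy.ac_deriv.ae_differentiableAt] with x h1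
  simp only [tau, Pi.smul_apply, h, deriv_const_smul c h1, smul_eq_mul]
  ring

theorem InDmax.add {q : ℝ → ℝ} {y z : ℝ → ℂ} (hy : InDmax q y) (hz : InDmax q z) :
    InDmax q (y + z) where
  regular := hy.regular.add hz.regular
  memLp := hy.memLp.add hz.memLp
  memLp_tau := (hy.memLp_tau.add hz.memLp_tau).ae_eq (tau_add hy.regular hz.regular).symm

theorem InDmax.smul {q : ℝ → ℝ} {y : ℝ → ℂ} (c : ℂ) (hy : InDmax q y) :
    InDmax q (c • y) where
  regular := hy.regular.smul c
  memLp := hy.memLp.const_smul c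
  memLp_tau := (hy.memLp_tau.const_smul c).ae_eq (tau_smul c hy.regular).symm

theorem inDmax_zero (q : ℝ → ℝ) : InDmax q 0 := by
  have h0 : deriv (0 : ℝ → ℂ) = 0 := by
    funext x
    exact deriv_const x (0 : ℂ)
  have hac : IsACLoc (0 : ℝ → ℂ) := by
    intro a b
    simpa [AbsolutelyContinuousOnInterval] using tendsto_const_nhds
  have ht : tau q 0 = 0 := by
    funext x
    simp only [tau, h0]
    simp
  exact ⟨⟨differentiable_const 0, hac, by rw [h0]; exact hac⟩, MemLp.zero,
    by rw [ht]; exact MemLp.zero⟩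

theorem IsRegular.eq_of_ae_eq {y z : ℝ → ℂ} (hy : IsRegular y) (hz : IsRegular z)
    (h : y =ᵐ[volume] z) : y = z :=
  (hy.differentiable.continuous.ae_eq_iff_eq volume hz.differentiable.continuous).1 h

/-- The domain of the maximal operator, as a subspace of `L²(ℝ)`. -/
def maxDomain (q : ℝ → ℝ) : Submodule ℂ L2 where
  carrier := {f | ∃ y : ℝ → ℂ, InDmax q y ∧ f =ᵐ[volume] y}
  add_mem' := by
    rintro f g ⟨y, hy, hfy⟩ ⟨z, hz, hgz⟩
    exact ⟨y + z, hy.add hz, (Lp.coeFn_add f g).trans (hfy.add hgz)⟩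
  zero_mem' := ⟨0, inDmax_zero q, Lp.coeFn_zero _ _ _⟩
  smul_mem' := by
    rintro c f ⟨y, hy, hfy⟩
    exact ⟨c • y, hy.smul c, (Lp.coeFn_smul c f).trans (hfy.const_smul c)⟩

/-- The unique continuously differentiable representative of an element of the maximal domain. -/
def rep {q : ℝ → ℝ} (f : maxDomain q) : ℝ → ℂ := Classical.choose f.2

theorem rep_inDmax {q : ℝ → ℝ} (f : maxDomain q) : InDmax q (rep f) :=
  (Classical.choose_spec f.2).1

theorem rep_ae {q : ℝ → ℝ} (f : maxDomain q) : (f : L2) =ᵐ[volume] rep f :=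
  (Classical.choose_spec f.2).2

theorem rep_eq {q : ℝ → ℝ} (f : maxDomain q) {y : ℝ → ℂ} (hy : IsRegular y)
    (h : (f : L2) =ᵐ[volume] y) : rep f = y :=
  (rep_inDmax f).regular.eq_of_ae_eq hy ((rep_ae f).symm.trans h)

theorem rep_add {q : ℝ → ℝ} (f g : maxDomain q) : rep (f + g) = rep f + rep g :=
  rep_eq _ ((rep_inDmax f).regular.add (rep_inDmax g).regular)
    ((Lp.coeFn_add (f : L2) (g : L2)).trans ((rep_ae f).add (rep_ae g)))

theorem rep_smul {q : ℝ → ℝ} (c : ℂ) (f : maxDomain q) : rep (c • f) = c • rep f :=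
  rep_eq _ ((rep_inDmax f).regular.smul c)
    ((Lp.coeFn_smul c (f : L2)).trans ((rep_ae f).const_smul c))

/-- The maximal operator `y ↦ τ_q y` on the maximal domain. -/
def maxOperator (q : ℝ → ℝ) : L2 →ₗ.[ℂ] L2 where
  domain := maxDomain q
  toFun :=
    { toFun := fun f => (rep_inDmax f).memLp_tau.toLp (tau q (rep f))
      map_add' := by
        intro f g
        rw [← MemLp.toLp_add]
        refine MemLp.toLp_congr _ _ ?_
        rw [rep_add]
        exact tau_add (rep_inDmax f).regular (rep_inDmax g).regular
      map_smul' := by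
        intro c f
        rw [RingHom.id_apply, ← MemLp.toLp_const_smul]
        refine MemLp.toLp_congr _ _ ?_
        rw [rep_smul]
        exact tau_smul c (rep_inDmax f).regular }

theorem maxOperator_ae {q : ℝ → ℝ} (f : (maxOperator q).domain) {y : ℝ → ℂ}
    (hy : InDmax q y) (h : (f : L2) =ᵐ[volume] y) :
    maxOperator q f =ᵐ[volume] tau q y := by
  have h1 : rep (q := q) f = y := rep_eq (q := q) f hy.regular h
  rw [← h1]
  exact MemLp.coeFn_toLp (rep_inDmax (q := q) f).memLp_tau

/-! ### Boundary values and separated boundary conditions -/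

/-- `[f, g]_x = conj (f x) g'(x) - conj (f'(x)) g(x)`. -/
def bracket (f g : ℝ → ℂ) (x : ℝ) : ℂ :=
  (starRingEnd ℂ) (f x) * deriv g x - (starRingEnd ℂ) (deriv f x) * g x

/-- `w₁` and `w₂` are real-valued solutions of `τ_q y = 0` in the maximal domain, `w₁` odd and
`w₂` even, with `[w₁, w₂]_{±∞} = 1`. -/
structure IsFundamentalPair (q : ℝ → ℝ) (w₁ w₂ : ℝ → ℂ) : Prop where
  dmax₁ : InDmax q w₁
  dmax₂ : InDmax q w₂
  sol₁ : IsSolution q 0 w₁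
  sol₂ : IsSolution q 0 w₂
  real₁ : ∀ x, (w₁ x).im = 0
  real₂ : ∀ x, (w₂ x).im = 0
  odd₁ : Function.Odd w₁
  even₂ : Function.Even w₂
  bracket_bot : Tendsto (bracket w₁ w₂) atBot (𝓝 1)
  bracket_top : Tendsto (bracket w₁ w₂) atTop (𝓝 1)

/-- The boundary values of `y` are `α₁(y) = [w₁, y]_{-∞} = a₁`, `α₂(y) = [w₂, y]_{-∞} = a₂`,
`β₁(y) = [w₁, y]_{∞} = b₁` and `β₂(y) = [w₂, y]_{∞} = b₂`. -/
structure HasBoundaryValues (w₁ w₂ y : ℝ → ℂ) (a₁ a₂ b₁ b₂ : ℂ) : Prop where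
  α₁ : Tendsto (bracket w₁ y) atBot (𝓝 a₁)
  α₂ : Tendsto (bracket w₂ y) atBot (𝓝 a₂)
  β₁ : Tendsto (bracket w₁ y) atTop (𝓝 b₁)
  β₂ : Tendsto (bracket w₂ y) atTop (𝓝 b₂)

/-- The separated boundary conditions
`α₁(y) ξ cos α - α₂(y) sin α = 0` and `β₁(y) η cos β - β₂(y) sin β = 0`. -/
def SeparatedBC (w₁ w₂ : ℝ → ℂ) (ξ η : ℂ) (α β : ℝ) (y : ℝ → ℂ) : Prop :=
  ∃ a₁ a₂ b₁ b₂ : ℂ, HasBoundaryValues w₁ w₂ y a₁ a₂ b₁ b₂ ∧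
    a₁ * ξ * (Real.cos α : ℂ) - a₂ * (Real.sin α : ℂ) = 0 ∧
    b₁ * η * (Real.cos β : ℂ) - b₂ * (Real.sin β : ℂ) = 0

theorem bracket_add (w : ℝ → ℂ) {y z : ℝ → ℂ} (hy : IsRegular y) (hz : IsRegular z) :
    bracket w (y + z) = fun x => bracket w y x + bracket w z x := by
  funext x
  simp only [bracket, Pi.add_apply, deriv_add (hy.differentiable x) (hz.differentiable x)]
  ring

theorem bracket_smul (w : ℝ → ℂ) {y : ℝ → ℂ} (c : ℂ) (hy : IsRegular y) :
    bracket w (c • y) = fun x => c * bracket w y x := by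
  funext x
  simp only [bracket, Pi.smul_apply, deriv_const_smul c (hy.differentiable x), smul_eq_mul]
  ring

/-- The elements of the maximal domain satisfying the separated boundary conditions. -/
def separatedDomain (q : ℝ → ℝ) (w₁ w₂ : ℝ → ℂ) (ξ η : ℂ) (α β : ℝ) : Submodule ℂ L2 where
  carrier := {f | ∃ y : ℝ → ℂ, InDmax q y ∧ f =ᵐ[volume] y ∧ SeparatedBC w₁ w₂ ξ η α β y}
  add_mem' := by
    rintro f g ⟨y, hy, hfy, a₁, a₂, b₁, b₂, hb, h1, h2⟩
      ⟨z, hz, hgz, a₁', a₂', b₁', b₂', hb', h1', h2'⟩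
    refine ⟨y + z, hy.add hz, (Lp.coeFn_add f g).trans (hfy.add hgz),
      a₁ + a₁', a₂ + a₂', b₁ + b₁', b₂ + b₂', ⟨?_, ?_, ?_, ?_⟩, ?_, ?_⟩
    · rw [bracket_add w₁ hy.regular hz.regular]
      exact hb.α₁.add hb'.α₁
    · rw [bracket_add w₂ hy.regular hz.regular]
      exact hb.α₂.add hb'.α₂
    · rw [bracket_add w₁ hy.regular hz.regular]
      exact hb.β₁.add hb'.β₁
    · rw [bracket_add w₂ hy.regular hz.regular]
      exact hb.β₂.add hb'.β₂
    · linear_combination h1 + h1'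
    · linear_combination h2 + h2'
  zero_mem' := by
    have h0 : ∀ w : ℝ → ℂ, bracket w 0 = fun _ => 0 := by
      intro w
      funext x
      have h : deriv (0 : ℝ → ℂ) x = 0 := deriv_const x (0 : ℂ)
      simp [bracket, h]
    refine ⟨0, inDmax_zero q, Lp.coeFn_zero _ _ _, 0, 0, 0, 0, ⟨?_, ?_, ?_, ?_⟩, by simp, by simp⟩
    all_goals
      rw [h0]
      exact tendsto_const_nhds
  smul_mem' := by
    rintro c f ⟨y, hy, hfy, a₁, a₂, b₁, b₂, hb, h1, h2⟩
    refine ⟨c • y, hy.smul c, (Lp.coeFn_smul c f).trans (hfy.const_smul c),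
      c * a₁, c * a₂, c * b₁, c * b₂, ⟨?_, ?_, ?_, ?_⟩, ?_, ?_⟩
    · rw [bracket_smul w₁ c hy.regular]
      exact hb.α₁.const_mul c
    · rw [bracket_smul w₂ c hy.regular]
      exact hb.α₂.const_mul c
    · rw [bracket_smul w₁ c hy.regular]
      exact hb.β₁.const_mul c
    · rw [bracket_smul w₂ c hy.regular]
      exact hb.β₂.const_mul c
    · linear_combination c * h1
    · linear_combination c * h2

/-- The restriction of the maximal operator to the functions that satisfy the separated boundary
conditions with parameters `ξ, η, α, β`. -/
def separatedExtension (q : ℝ → ℝ) (w₁ w₂ : ℝ → ℂ) (ξ η : ℂ) (α β : ℝ) : L2 →ₗ.[ℂ] L2 :=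
  (maxOperator q).domRestrict (separatedDomain q w₁ w₂ ξ η α β)

theorem mem_separatedExtension_domain {q : ℝ → ℝ} {w₁ w₂ : ℝ → ℂ} {ξ η : ℂ} {α β : ℝ} {f : L2} :
    f ∈ (separatedExtension q w₁ w₂ ξ η α β).domain ↔
      ∃ y : ℝ → ℂ, InDmax q y ∧ f =ᵐ[volume] y ∧ SeparatedBC w₁ w₂ ξ η α β y :=
  ⟨fun h => h.1, fun h => ⟨h, by obtain ⟨y, hy, hfy, -⟩ := h; exact ⟨y, hy, hfy⟩⟩⟩

/-- The pair `(ξ, α)` describes the condition `ξ cos α · z₁ = sin α · z₂` without sign ambiguity: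
`ξ ≠ -1` (as `(-1, α)` describes the same condition as `(1, -α)`), and `ξ = 1` if
`sin α cos α = 0` (where the condition does not depend on `ξ`). -/
def IsNormalized (ξ : ℂ) (α : ℝ) : Prop :=
  ξ ≠ -1 ∧ (Real.sin α * Real.cos α = 0 → ξ = 1)

end

end PTQM

/-!
The boundary values `((α₁, α₂), (β₁, β₂))` map the maximal domain onto `ℂ² × ℂ²`, and by the
Plücker identity for `w₁, w₂` Green's form of `A_max` is the difference of the standard symplectic
forms of the two ends. Hence the restriction of `A_max` to boundary values in a subspace has as
adjoint the restriction to the symplectic complement; in `ℂ²` a line `ℂ (sin α, ξ cos α)` has as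
complement its image under `ξ ↦ conj ξ`. Parity exchanges the two ends and flips the sign of the
second coordinate, time reversal conjugates the coordinates, so each of the three symmetries
becomes an equality between such lines.

That every boundary value occurs, and that `A_max` is the adjoint of its restriction to vanishing
boundary values, both come from variation of parameters: since `w₁, w₂` form a square integrable
basis of solutions of `τ y = 0`, integrating `g` against them solves `τ y = g` with prescribed
boundary values at `-∞`, and the boundary values at `+∞` then differ by `⟪w₁, g⟫` and `⟪w₂, g⟫`.
-/

namespace PTQM

open scoped ComplexConjugate InnerProductSpace

/-! ### Boundary systems -/

/-- A boundary system for an operator `A` that need not be densely defined: a surjective map `Γ`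
from `dom A` onto a space `G` of boundary values, together with a sesquilinear form `ω` on `G` for
which Green's formula `⟪A f, g⟫ - ⟪f, A g⟫ = ω (Γ f) (Γ g)` holds. The field `maximal` says that
the adjoint of the restriction of `A` to `ker Γ` is contained in `A`. It is spelled out because
`LinearPMap.adjoint` takes a junk value unless that restriction is densely defined, which is a
consequence. -/
structure BoundarySystem {𝕜 H : Type*} [RCLike 𝕜] [NormedAddCommGroup H] [InnerProductSpace 𝕜 H]
    (A : H →ₗ.[𝕜] H) (G : Type*) [AddCommGroup G] [Module 𝕜 G] where
  toMap : A.domain →ₗ[𝕜] G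
  form : G →ₗ⋆[𝕜] G →ₗ[𝕜] 𝕜
  surjective : Function.Surjective toMap
  green : ∀ f g : A.domain, ⟪A f, g⟫_𝕜 - ⟪(f : H), A g⟫_𝕜 = form (toMap f) (toMap g)
  maximal : ∀ v h : H, (∀ f : A.domain, toMap f = 0 → ⟪h, f⟫_𝕜 = ⟪v, A f⟫_𝕜) →
    ∃ hv : v ∈ A.domain, A ⟨v, hv⟩ = h

namespace BoundarySystem

variable {𝕜 H G : Type*} [RCLike 𝕜] [NormedAddCommGroup H] [InnerProductSpace 𝕜 H]
  [AddCommGroup G] [Module 𝕜 G] {A : H →ₗ.[𝕜] H}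

theorem maximal_of_ker {Γ : A.domain →ₗ[𝕜] G} {ω : G →ₗ⋆[𝕜] G →ₗ[𝕜] 𝕜}
    (green : ∀ f g : A.domain, ⟪A f, g⟫_𝕜 - ⟪(f : H), A g⟫_𝕜 = ω (Γ f) (Γ g))
    (surj : ∀ u, ∃ f, A f = u) {N : Submodule 𝕜 H} [N.HasOrthogonalProjection]
    (hN : ∀ n ∈ N, ∃ hn : n ∈ A.domain, A ⟨n, hn⟩ = 0)
    (hker : ∀ u ∈ Nᗮ, ∃ f, Γ f = 0 ∧ A f = u) {v h : H}
    (hvh : ∀ f : A.domain, Γ f = 0 → ⟪h, f⟫_𝕜 = ⟪v, A f⟫_𝕜) :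
    ∃ hv : v ∈ A.domain, A ⟨v, hv⟩ = h := by
  obtain ⟨z, rfl⟩ := surj h
  have hmem : v - z ∈ N := by
    rw [← N.orthogonal_orthogonal, Submodule.mem_orthogonal']
    intro u hu
    obtain ⟨f, hf, rfl⟩ := hker u hu
    have hgreen := green z f
    rw [hf, map_zero, hvh f hf, ← inner_sub_left] at hgreen
    exact hgreen
  obtain ⟨hn, hA⟩ := hN _ hmem
  have hv : v = (z + ⟨v - z, hn⟩ : A.domain) := by simp
  refine ⟨hv ▸ Subtype.coe_prop _, ?_⟩
  rw [show (⟨v, _⟩ : A.domain) = z + ⟨v - z, hn⟩ from Subtype.ext hv, LinearPMap.map_add, hA,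
    add_zero]

/-- The restriction of `A` to the vectors whose boundary values lie in `L`. -/
def restrict (Γ : BoundarySystem A G) (L : Submodule 𝕜 G) : H →ₗ.[𝕜] H :=
  A.domRestrict ((L.comap Γ.toMap).map A.domain.subtype)

variable (Γ : BoundarySystem A G) {L L' : Submodule 𝕜 G}

theorem mem_restrict_domain_iff {f : H} :
    f ∈ (Γ.restrict L).domain ↔ ∃ hf : f ∈ A.domain, Γ.toMap ⟨f, hf⟩ ∈ L := by
  simp [restrict, LinearPMap.domRestrict_domain]

theorem coe_mem_restrict_domain_iff {f : A.domain} :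
    (f : H) ∈ (Γ.restrict L).domain ↔ Γ.toMap f ∈ L := by
  simp [mem_restrict_domain_iff]

theorem restrict_apply {f : (Γ.restrict L).domain} {g : A.domain} (h : (f : H) = g) :
    Γ.restrict L f = A g :=
  LinearPMap.domRestrict_apply h

theorem restrict_domain_le_iff : (Γ.restrict L).domain ≤ (Γ.restrict L').domain ↔ L ≤ L' := by
  refine ⟨fun h z hz => ?_, fun h f hf => ?_⟩
  · obtain ⟨f, rfl⟩ := Γ.surjective z
    exact Γ.coe_mem_restrict_domain_iff.1 (h (Γ.coe_mem_restrict_domain_iff.2 hz))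
  · rw [mem_restrict_domain_iff] at hf ⊢
    exact hf.imp fun _ => @h _

variable [CompleteSpace H]

theorem dense_restrict_domain : Dense ((Γ.restrict L).domain : Set H) := by
  rw [Submodule.dense_iff_topologicalClosure_eq_top, Submodule.topologicalClosure_eq_top_iff,
    Submodule.eq_bot_iff]
  intro h hh
  obtain ⟨h0, hA⟩ := Γ.maximal 0 h fun f hf => by
    rw [inner_zero_left]
    exact (Submodule.mem_orthogonal' _ _).1 hh f
      (Γ.coe_mem_restrict_domain_iff.2 (hf ▸ L.zero_mem))
  rw [← hA]
  exact A.map_zero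

theorem adjoint_restrict : (Γ.restrict L).adjoint = Γ.restrict (L.orthogonalBilin Γ.form) := by
  have hadj := LinearPMap.adjoint_isFormalAdjoint (Γ.dense_restrict_domain (L := L))
  have hle : Γ.restrict (L.orthogonalBilin Γ.form) ≤ (Γ.restrict L).adjoint := by
    refine LinearPMap.IsFormalAdjoint.le_adjoint Γ.dense_restrict_domain fun f g => ?_
    obtain ⟨hf, hfL⟩ := Γ.mem_restrict_domain_iff.1 f.2
    obtain ⟨hg, hgL⟩ := Γ.mem_restrict_domain_iff.1 g.2
    rw [Γ.restrict_apply (g := ⟨f, hf⟩) rfl, Γ.restrict_apply (g := ⟨g, hg⟩) rfl]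
    exact sub_eq_zero.1 ((Γ.green ⟨f, hf⟩ ⟨g, hg⟩).trans (hgL _ hfL))
  refine (LinearPMap.eq_of_le_of_domain_eq hle (le_antisymm hle.1 fun v hv => ?_)).symm
  have hinner (f : A.domain) (hf : Γ.toMap f ∈ L) :
      ⟪(Γ.restrict L).adjoint ⟨v, hv⟩, f⟫_𝕜 = ⟪v, A f⟫_𝕜 := by
    rw [← Γ.restrict_apply (f := ⟨f, Γ.coe_mem_restrict_domain_iff.2 hf⟩) rfl]
    exact hadj ⟨v, hv⟩ ⟨f, Γ.coe_mem_restrict_domain_iff.2 hf⟩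
  obtain ⟨hvA, hAv⟩ := Γ.maximal v _ fun f hf => hinner f (hf ▸ L.zero_mem)
  refine Γ.mem_restrict_domain_iff.2 ⟨hvA, fun z hz => ?_⟩
  obtain ⟨f, rfl⟩ := Γ.surjective z
  rw [← Γ.green, hAv, ← inner_conj_symm, ← hinner f hz, inner_conj_symm, sub_self]

end BoundarySystem

/-! ### Absolutely continuous functions -/

section AbsolutelyContinuous

theorem absolutelyContinuousOnInterval_of_dist_le {X Y : Type*} [PseudoMetricSpace X]
    [PseudoMetricSpace Y] {f : ℝ → X} {g : ℝ → Y} {a b : ℝ}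
    (hg : AbsolutelyContinuousOnInterval g a b)
    (hfg : ∀ x ∈ Set.uIcc a b, ∀ y ∈ Set.uIcc a b, dist (f x) (f y) ≤ dist (g x) (g y)) :
    AbsolutelyContinuousOnInterval f a b := by
  rw [absolutelyContinuousOnInterval_iff] at hg ⊢
  intro ε hε
  obtain ⟨δ, hδ, H⟩ := hg ε hε
  refine ⟨δ, hδ, fun E hE hlen => (H E hE hlen).trans_le' (Finset.sum_le_sum fun i hi => ?_)⟩
  exact hfg _ (hE.1 i hi).1 _ (hE.1 i hi).2

theorem absolutelyContinuousOnInterval_comp_neg {X : Type*} [PseudoMetricSpace X] {f : ℝ → X}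
    {a b : ℝ} (hf : AbsolutelyContinuousOnInterval f (-a) (-b)) :
    AbsolutelyContinuousOnInterval (fun x => f (-x)) a b := by
  rw [absolutelyContinuousOnInterval_iff] at hf ⊢
  intro ε hε
  obtain ⟨δ, hδ, H⟩ := hf ε hε
  refine ⟨δ, hδ, fun E hE hlen => H (E.1, fun i => (-(E.2 i).1, -(E.2 i).2)) ⟨?_, ?_⟩ ?_⟩
  · intro i hi
    have := hE.1 i hi
    simp only [Set.mem_uIcc] at this ⊢
    grind
  · intro i hi j hj hij
    have := hE.2 hi hj hij
    simp only [Function.onFun, Set.uIoc, Set.Ioc_disjoint_Ioc] at this ⊢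
    grind
  · simpa only [dist_neg_neg] using hlen

variable {E : Type*} [NormedAddCommGroup E] [NormedSpace ℝ E] {f g : ℝ → E} {a b : ℝ}

theorem absolutelyContinuousOnInterval_integral (hg : IntervalIntegrable g volume a b) :
    AbsolutelyContinuousOnInterval (fun x => ∫ t in a..x, g t) a b := by
  refine absolutelyContinuousOnInterval_of_dist_le
    (hg.norm.absolutelyContinuousOnInterval_intervalIntegral Set.left_mem_uIcc) fun x hx y hy => ?_
  have hint (z : ℝ) (hz : z ∈ Set.uIcc a b) : IntervalIntegrable g volume a z :=
    hg.mono_set (Set.uIcc_subset_uIcc_left hz)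
  rw [dist_eq_norm, dist_eq_norm, Real.norm_eq_abs,
    intervalIntegral.integral_interval_sub_left (hint x hx) (hint y hy),
    intervalIntegral.integral_interval_sub_left (hint x hx).norm (hint y hy).norm]
  exact intervalIntegral.norm_integral_le_abs_integral_norm

theorem absolutelyContinuousOnInterval_setIntegral_Iic (hg : Integrable g) :
    AbsolutelyContinuousOnInterval (fun x => ∫ t in Set.Iic x, g t) a b := by
  refine absolutelyContinuousOnInterval_of_dist_le
    (absolutelyContinuousOnInterval_integral hg.intervalIntegrable) fun x _ y _ => ?_
  rw [dist_eq_norm, dist_eq_norm, intervalIntegral.integral_interval_sub_left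
    hg.intervalIntegrable hg.intervalIntegrable,
    intervalIntegral.integral_Iic_sub_Iic hg.integrableOn hg.integrableOn]

theorem integral_eq_sub_of_ae_hasDerivAt [CompleteSpace E]
    (hf : AbsolutelyContinuousOnInterval f a b) (hg : IntervalIntegrable g volume a b)
    (hfg : ∀ᵐ x, HasDerivAt f (g x) x) :
    ∫ x in a..b, g x = f b - f a := by
  obtain ⟨C, hC⟩ := (hf.fun_sub (absolutelyContinuousOnInterval_integral hg))
    |>.const_of_ae_hasDerivAt_zero (by
      filter_upwards [hfg, hg.ae_hasDerivAt_integral] with x h₁ h₂ hx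
      simpa using h₁.fun_sub (h₂ hx a Set.left_mem_uIcc))
  have hab := (hC a Set.left_mem_uIcc).trans (hC b Set.right_mem_uIcc).symm
  rw [intervalIntegral.integral_same, sub_zero] at hab
  rw [hab, sub_sub_cancel]

theorem hasDerivAt_of_ae_hasDerivAt [CompleteSpace E]
    (hf : ∀ a b, AbsolutelyContinuousOnInterval f a b) (hg : Continuous g)
    (hfg : ∀ᵐ x, HasDerivAt f (g x) x) (x : ℝ) : HasDerivAt f (g x) x := by
  have h : f = fun x => f 0 + ∫ t in (0 : ℝ)..x, g t := funext fun x => by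
    rw [integral_eq_sub_of_ae_hasDerivAt (hf 0 x) (hg.intervalIntegrable _ _) hfg,
      add_sub_cancel]
  rw [h]
  exact (intervalIntegral.integral_hasDerivAt_right (hg.intervalIntegrable _ _)
    (hg.stronglyMeasurableAtFilter _ _) hg.continuousAt).const_add _

theorem ae_hasDerivAt_setIntegral_Iic [CompleteSpace E] (hg : Integrable g) :
    ∀ᵐ x, HasDerivAt (fun x => ∫ t in Set.Iic x, g t) (g x) x := by
  have h : (fun x => ∫ t in Set.Iic x, g t) =
      fun x => (∫ t in Set.Iic (0 : ℝ), g t) + ∫ t in (0 : ℝ)..x, g t := funext fun x => by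
    rw [← intervalIntegral.integral_Iic_sub_Iic hg.integrableOn hg.integrableOn, add_sub_cancel]
  rw [h]
  filter_upwards [LocallyIntegrable.ae_hasDerivAt_integral hg.locallyIntegrable] with x hx
  exact (hx 0).const_add _

theorem tendsto_setIntegral_Iic_atTop (hg : Integrable g) :
    Tendsto (fun x => ∫ t in Set.Iic x, g t) atTop (𝓝 (∫ t, g t)) :=
  (aecover_Iic tendsto_id).integral_tendsto_of_countably_generated hg

theorem exists_eq_add_setIntegral_Iic [CompleteSpace E]
    (hf : ∀ a b, AbsolutelyContinuousOnInterval f a b) (hg : Integrable g)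
    (hfg : ∀ᵐ x, HasDerivAt f (g x) x) : ∃ c, f = fun x => c + ∫ t in Set.Iic x, g t := by
  refine ⟨f 0 - ∫ t in Set.Iic (0 : ℝ), g t, funext fun x => ?_⟩
  have h := integral_eq_sub_of_ae_hasDerivAt (hf 0 x) hg.intervalIntegrable hfg
  rw [← intervalIntegral.integral_Iic_sub_Iic hg.integrableOn hg.integrableOn] at h
  rw [sub_add_eq_add_sub, add_sub_assoc, h, add_sub_cancel]

end AbsolutelyContinuous

section Lagrange

variable {q : ℝ → ℝ} {f g : ℝ → ℂ}

theorem IsACLoc.continuous (hf : IsACLoc f) : Continuous f := by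
  refine continuous_iff_continuousAt.2 fun x => ?_
  refine (hf (x - 1) (x + 1)).continuousOn.continuousAt ?_
  rw [Set.uIcc_of_le (by linarith)]
  exact Icc_mem_nhds (by linarith) (by linarith)

theorem IsACLoc.mul (hf : IsACLoc f) (hg : IsACLoc g) : IsACLoc fun x => f x * g x :=
  fun a b => (hf a b).fun_smul (hg a b)

theorem IsACLoc.sub (hf : IsACLoc f) (hg : IsACLoc g) : IsACLoc fun x => f x - g x :=
  fun a b => (hf a b).fun_sub (hg a b)

theorem IsACLoc.neg (hf : IsACLoc f) : IsACLoc fun x => -f x :=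
  fun a b => (hf a b).fun_neg

theorem IsACLoc.conj (hf : IsACLoc f) : IsACLoc fun x => conj (f x) :=
  fun a b => absolutelyContinuousOnInterval_of_dist_le (hf a b) fun _ _ _ _ =>
    (Complex.dist_conj_conj _ _).le

theorem IsACLoc.comp_neg (hf : IsACLoc f) : IsACLoc fun x => f (-x) :=
  fun _ _ => absolutelyContinuousOnInterval_comp_neg (hf _ _)

theorem isACLoc_const (c : ℂ) : IsACLoc fun _ => c :=
  fun _ _ => contDiffOn_const.absolutelyContinuousOnInterval

/-! ### Lagrange's identity -/

theorem IsRegular.isACLoc_bracket (hf : IsRegular f) (hg : IsRegular g) :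
    IsACLoc (bracket f g) :=
  (hf.ac.conj.mul hg.ac_deriv).sub (hf.ac_deriv.conj.mul hg.ac)

theorem IsRegular.ae_hasDerivAt_bracket (q : ℝ → ℝ) (hf : IsRegular f) (hg : IsRegular g) :
    ∀ᵐ x, HasDerivAt (bracket f g) (conj (tau q f x) * g x - conj (f x) * tau q g x) x := by
  filter_upwards [hf.ac_deriv.ae_differentiableAt, hg.ac_deriv.ae_differentiableAt] with x hf' hg'
  have h := ((hf.differentiable x).hasDerivAt.star.mul hg'.hasDerivAt).sub
    (hf'.hasDerivAt.star.mul (hg.differentiable x).hasDerivAt)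
  refine h.congr_deriv ?_
  simp only [tau, map_sub, map_neg, map_mul, Complex.conj_ofReal, Complex.star_def]
  ring

theorem integrable_conj_mul (hf : MemLp f 2) (hg : MemLp g 2) :
    Integrable fun x => conj (f x) * g x :=
  hf.star.integrable_mul hg

theorem InDmax.integrable_lagrange (hf : InDmax q f) (hg : InDmax q g) :
    Integrable fun x => conj (tau q f x) * g x - conj (f x) * tau q g x :=
  (integrable_conj_mul hf.memLp_tau hg.memLp).sub (integrable_conj_mul hf.memLp hg.memLp_tau)

theorem InDmax.exists_bracket_eq (hf : InDmax q f) (hg : InDmax q g) :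
    ∃ c, bracket f g = fun x =>
      c + ∫ t in Set.Iic x, conj (tau q f t) * g t - conj (f t) * tau q g t :=
  exists_eq_add_setIntegral_Iic (hf.regular.isACLoc_bracket hg.regular) (hf.integrable_lagrange hg)
    (hf.regular.ae_hasDerivAt_bracket q hg.regular)

theorem InDmax.exists_tendsto_bracket (hf : InDmax q f) (hg : InDmax q g) :
    ∃ c, Tendsto (bracket f g) atBot (𝓝 c) ∧ Tendsto (bracket f g) atTop
      (𝓝 (c + ((∫ x, conj (tau q f x) * g x) - ∫ x, conj (f x) * tau q g x))) := by
  obtain ⟨c, hc⟩ := hf.exists_bracket_eq hg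
  rw [hc, ← integral_sub (integrable_conj_mul hf.memLp_tau hg.memLp)
    (integrable_conj_mul hf.memLp hg.memLp_tau)]
  refine ⟨c, ?_, (tendsto_setIntegral_Iic_atTop (hf.integrable_lagrange hg)).const_add c⟩
  simpa only [add_zero, id] using (tendsto_integral_Iic_zero tendsto_id).const_add c

theorem IsSolution.tau_ae_eq_zero {w : ℝ → ℂ} (h : IsSolution q 0 w) : tau q w =ᵐ[volume] 0 := by
  filter_upwards [h.eqn] with x hx
  simpa using hx

theorem bracket_eq_const_of_isSolution (hf : InDmax q f) (hg : InDmax q g)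
    (hf₀ : IsSolution q 0 f) (hg₀ : IsSolution q 0 g) : ∃ c, bracket f g = fun _ => c := by
  obtain ⟨c, hc⟩ := hf.exists_bracket_eq hg
  refine ⟨c, hc.trans (funext fun x => add_eq_left.2 ?_)⟩
  refine integral_eq_zero_of_ae (ae_restrict_of_ae ?_)
  filter_upwards [hf₀.tau_ae_eq_zero, hg₀.tau_ae_eq_zero] with t hft hgt
  simp [hft, hgt]

end Lagrange

/-! ### Fundamental pairs and variation of parameters -/

theorem deriv_conj (y : ℝ → ℂ) : deriv (fun x => conj (y x)) = fun x => conj (deriv y x) :=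
  funext fun _ => deriv.star

theorem deriv_reflect (y : ℝ → ℂ) : deriv (fun x => y (-x)) = fun x => -deriv y (-x) :=
  funext fun x => deriv_comp_neg y x

theorem bracket_conj (f g : ℝ → ℂ) :
    bracket (fun x => conj (f x)) (fun x => conj (g x)) = fun x => conj (bracket f g x) := by
  funext x
  simp only [bracket, deriv_conj, map_sub, map_mul]

theorem bracket_reflect (f g : ℝ → ℂ) :
    bracket (fun x => f (-x)) (fun x => g (-x)) = fun x => -bracket f g (-x) := by
  funext x
  simp only [bracket, deriv_reflect, map_neg]
  ring

theorem bracket_neg_left (f g : ℝ → ℂ) : bracket (fun x => -f x) g = fun x => -bracket f g x := by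
  funext x
  simp only [bracket, deriv.fun_neg, map_neg]
  ring

namespace IsFundamentalPair

variable {q : ℝ → ℝ} {w₁ w₂ : ℝ → ℂ} (hw : IsFundamentalPair q w₁ w₂)
include hw

theorem conj₁ : (fun x => conj (w₁ x)) = w₁ :=
  funext fun x => Complex.conj_eq_iff_im.2 (hw.real₁ x)

theorem conj₂ : (fun x => conj (w₂ x)) = w₂ :=
  funext fun x => Complex.conj_eq_iff_im.2 (hw.real₂ x)

theorem bracket₁ (y : ℝ → ℂ) (x : ℝ) : bracket w₁ y x = w₁ x * deriv y x - deriv w₁ x * y x := by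
  have h := deriv_conj w₁
  rw [hw.conj₁] at h
  rw [bracket, congrFun hw.conj₁ x, ← congrFun h x]

theorem bracket₂ (y : ℝ → ℂ) (x : ℝ) : bracket w₂ y x = w₂ x * deriv y x - deriv w₂ x * y x := by
  have h := deriv_conj w₂
  rw [hw.conj₂] at h
  rw [bracket, congrFun hw.conj₂ x, ← congrFun h x]

theorem bracket_eq_one (x : ℝ) : bracket w₁ w₂ x = 1 := by
  obtain ⟨c, hc⟩ := bracket_eq_const_of_isSolution hw.dmax₁ hw.dmax₂ hw.sol₁ hw.sol₂
  have htop := hw.bracket_top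
  rw [hc] at htop ⊢
  exact tendsto_nhds_unique tendsto_const_nhds htop

theorem wronskian (x : ℝ) : w₁ x * deriv w₂ x - deriv w₁ x * w₂ x = 1 := by
  rw [← hw.bracket₁, hw.bracket_eq_one]

theorem bracket_eq (f g : ℝ → ℂ) (x : ℝ) :
    bracket f g x =
      conj (bracket w₁ f x) * bracket w₂ g x - conj (bracket w₂ f x) * bracket w₁ g x := by
  have h₁ := congrFun (bracket_conj w₁ f) x
  have h₂ := congrFun (bracket_conj w₂ f) x
  rw [hw.conj₁, hw.bracket₁, deriv_conj] at h₁
  rw [hw.conj₂, hw.bracket₂, deriv_conj] at h₂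
  rw [← h₁, ← h₂, hw.bracket₁, hw.bracket₂, bracket]
  linear_combination (-(conj (f x) * deriv g x - conj (deriv f x) * g x)) * hw.wronskian x

end IsFundamentalPair

/-- The function `w₂ B₁ - w₁ B₂` of the method of variation of parameters. -/
def variation (w₁ w₂ B₁ B₂ : ℝ → ℂ) (x : ℝ) : ℂ := w₂ x * B₁ x - w₁ x * B₂ x

/-- `B₁` and `B₂` are coefficients for which variation of parameters solves `τ_q y = u`:
`B₁' = -w₁ u` and `B₂' = -w₂ u` almost everywhere. -/
structure IsVariationCoeff (w₁ w₂ u B₁ B₂ : ℝ → ℂ) : Prop where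
  ac₁ : IsACLoc B₁
  ac₂ : IsACLoc B₂
  ae_hasDerivAt₁ : ∀ᵐ x, HasDerivAt B₁ (-(w₁ x * u x)) x
  ae_hasDerivAt₂ : ∀ᵐ x, HasDerivAt B₂ (-(w₂ x * u x)) x

namespace IsVariationCoeff

variable {w₁ w₂ u B₁ B₂ : ℝ → ℂ}

theorem isACLoc_variation {v₁ v₂ : ℝ → ℂ} (hB : IsVariationCoeff w₁ w₂ u B₁ B₂) (h₁ : IsACLoc v₁)
    (h₂ : IsACLoc v₂) : IsACLoc (variation v₁ v₂ B₁ B₂) :=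
  (h₂.mul hB.ac₁).sub (h₁.mul hB.ac₂)

theorem ae_hasDerivAt_variation {v₁ v₂ : ℝ → ℂ} (hB : IsVariationCoeff w₁ w₂ u B₁ B₂)
    (h₁ : IsACLoc v₁) (h₂ : IsACLoc v₂) :
    ∀ᵐ x, HasDerivAt (variation v₁ v₂ B₁ B₂)
      (variation (deriv v₁) (deriv v₂) B₁ B₂ x + (v₁ x * w₂ x - v₂ x * w₁ x) * u x) x := by
  filter_upwards [h₁.ae_differentiableAt, h₂.ae_differentiableAt, hB.ae_hasDerivAt₁,
    hB.ae_hasDerivAt₂] with x hv₁ hv₂ hB₁ hB₂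
  refine ((hv₂.hasDerivAt.mul hB₁).sub (hv₁.hasDerivAt.mul hB₂)).congr_deriv ?_
  simp only [variation]
  ring

variable (hB : IsVariationCoeff w₁ w₂ u B₁ B₂) (h₁ : IsRegular w₁) (h₂ : IsRegular w₂)
include hB h₁ h₂

theorem hasDerivAt_variation (x : ℝ) :
    HasDerivAt (variation w₁ w₂ B₁ B₂) (variation (deriv w₁) (deriv w₂) B₁ B₂ x) x := by
  refine hasDerivAt_of_ae_hasDerivAt (hB.isACLoc_variation h₁.ac h₂.ac)
    (hB.isACLoc_variation h₁.ac_deriv h₂.ac_deriv).continuous ?_ x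
  filter_upwards [hB.ae_hasDerivAt_variation h₁.ac h₂.ac] with x hx
  refine hx.congr_deriv ?_
  ring

theorem deriv_variation :
    deriv (variation w₁ w₂ B₁ B₂) = variation (deriv w₁) (deriv w₂) B₁ B₂ :=
  funext fun x => (hB.hasDerivAt_variation h₁ h₂ x).deriv

theorem isRegular_variation : IsRegular (variation w₁ w₂ B₁ B₂) where
  differentiable x := (hB.hasDerivAt_variation h₁ h₂ x).differentiableAt
  ac := hB.isACLoc_variation h₁.ac h₂.ac
  ac_deriv := by
    rw [hB.deriv_variation h₁ h₂]
    exact hB.isACLoc_variation h₁.ac_deriv h₂.ac_deriv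

end IsVariationCoeff

namespace IsFundamentalPair

variable {q : ℝ → ℝ} {w₁ w₂ u B₁ B₂ : ℝ → ℂ} (hw : IsFundamentalPair q w₁ w₂)
  (hB : IsVariationCoeff w₁ w₂ u B₁ B₂)
include hw hB

theorem bracket_variation₁ : bracket w₁ (variation w₁ w₂ B₁ B₂) = B₁ := by
  funext x
  rw [hw.bracket₁, hB.deriv_variation hw.dmax₁.regular hw.dmax₂.regular, variation, variation]
  linear_combination B₁ x * hw.wronskian x

theorem bracket_variation₂ : bracket w₂ (variation w₁ w₂ B₁ B₂) = B₂ := by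
  funext x
  rw [hw.bracket₂, hB.deriv_variation hw.dmax₁.regular hw.dmax₂.regular, variation, variation]
  linear_combination B₂ x * hw.wronskian x

theorem tau_variation : tau q (variation w₁ w₂ B₁ B₂) =ᵐ[volume] u := by
  filter_upwards [hw.sol₁.tau_ae_eq_zero, hw.sol₂.tau_ae_eq_zero,
    hB.ae_hasDerivAt_variation hw.dmax₁.regular.ac_deriv hw.dmax₂.regular.ac_deriv]
    with x hτ₁ hτ₂ hx
  rw [tau, hB.deriv_variation hw.dmax₁.regular hw.dmax₂.regular, hx.deriv]
  simp only [tau, Pi.zero_apply] at hτ₁ hτ₂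
  simp only [variation]
  linear_combination B₁ x * hτ₂ - B₂ x * hτ₁ + u x * hw.wronskian x

end IsFundamentalPair

theorem exists_hasDerivAt_neg_tendsto {g : ℝ → ℂ} (hg : Integrable g) (a : ℂ) :
    ∃ B : ℝ → ℂ, IsACLoc B ∧ (∀ᵐ x, HasDerivAt B (-g x) x) ∧ MemLp B ⊤ ∧
      Tendsto B atBot (𝓝 a) ∧ Tendsto B atTop (𝓝 (a - ∫ x, g x)) := by
  have hac : IsACLoc fun x => a - ∫ t in Set.Iic x, g t :=
    (isACLoc_const a).sub fun _ _ => absolutelyContinuousOnInterval_setIntegral_Iic hg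
  refine ⟨_, hac, ?_, memLp_top_of_bound hac.continuous.aestronglyMeasurable
    (‖a‖ + ∫ t, ‖g t‖) (Eventually.of_forall fun x => ?_), ?_,
    (tendsto_setIntegral_Iic_atTop hg).const_sub a⟩
  · filter_upwards [ae_hasDerivAt_setIntegral_Iic hg] with x hx
    exact hx.const_sub a
  · refine (norm_sub_le _ _).trans (add_le_add_right ?_ _)
    exact (norm_integral_le_integral_norm _).trans
      (setIntegral_le_integral hg.norm (Eventually.of_forall fun _ => norm_nonneg _))
  · simpa only [sub_zero, id] using (tendsto_integral_Iic_zero tendsto_id).const_sub a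

theorem IsFundamentalPair.exists_tau_eq {q : ℝ → ℝ} {w₁ w₂ u : ℝ → ℂ}
    (hw : IsFundamentalPair q w₁ w₂) (hu : MemLp u 2) (a₁ a₂ : ℂ) :
    ∃ y, InDmax q y ∧ tau q y =ᵐ[volume] u ∧
      HasBoundaryValues w₁ w₂ y a₁ a₂ (a₁ - ∫ x, w₁ x * u x) (a₂ - ∫ x, w₂ x * u x) := by
  obtain ⟨B₁, hac₁, hd₁, hLp₁, hbot₁, htop₁⟩ :=
    exists_hasDerivAt_neg_tendsto (hw.dmax₁.memLp.integrable_mul hu) a₁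
  obtain ⟨B₂, hac₂, hd₂, hLp₂, hbot₂, htop₂⟩ :=
    exists_hasDerivAt_neg_tendsto (hw.dmax₂.memLp.integrable_mul hu) a₂
  have hB : IsVariationCoeff w₁ w₂ u B₁ B₂ := ⟨hac₁, hac₂, hd₁, hd₂⟩
  have hτ := hw.tau_variation hB
  refine ⟨variation w₁ w₂ B₁ B₂, ⟨hB.isRegular_variation hw.dmax₁.regular hw.dmax₂.regular,
    (hLp₁.mul' hw.dmax₂.memLp).sub (hLp₂.mul' hw.dmax₁.memLp), hu.ae_eq hτ.symm⟩, hτ, ?_⟩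
  constructor <;> simpa only [hw.bracket_variation₁ hB, hw.bracket_variation₂ hB]

/-! ### The boundary system of the maximal operator -/

section BoundaryValues

variable {q : ℝ → ℝ} {w y z : ℝ → ℂ}

/-- A function in the maximal domain as a vector in the domain of the maximal operator. -/
noncomputable def InDmax.toDomain (hy : InDmax q y) : (maxOperator q).domain :=
  ⟨hy.memLp.toLp y, y, hy, hy.memLp.coeFn_toLp⟩

theorem InDmax.coe_toDomain_ae_eq (hy : InDmax q y) : (hy.toDomain : L2) =ᵐ[volume] y :=
  hy.memLp.coeFn_toLp

theorem InDmax.toDomain_ne_zero (hy : InDmax q y) (h : y ≠ 0) : (hy.toDomain : L2) ≠ 0 :=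
  fun h₀ => h (hy.regular.eq_of_ae_eq (inDmax_zero q).regular
    (hy.coe_toDomain_ae_eq.symm.trans (h₀ ▸ Lp.coeFn_zero _ _ _)))

theorem IsSolution.maxOperator_toDomain (h : IsSolution q 0 y) (hy : InDmax q y) :
    maxOperator q hy.toDomain = 0 :=
  Lp.ext ((maxOperator_ae _ hy hy.coe_toDomain_ae_eq).trans
    (h.tau_ae_eq_zero.trans (Lp.coeFn_zero _ _ _).symm))

theorem inner_eq_integral_of_ae_eq {f g : L2} (hf : f =ᵐ[volume] y) (hg : g =ᵐ[volume] z) :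
    ⟪f, g⟫_ℂ = ∫ x, conj (y x) * z x := by
  rw [L2.inner_def]
  refine integral_congr_ae ?_
  filter_upwards [hf, hg] with x hfx hgx
  rw [hfx, hgx, RCLike.inner_apply, mul_comm]

theorem exists_tendsto_bracket_rep (f g : (maxOperator q).domain) :
    ∃ c, Tendsto (bracket (rep (q := q) f) (rep (q := q) g)) atBot (𝓝 c) ∧
      Tendsto (bracket (rep (q := q) f) (rep (q := q) g)) atTop
        (𝓝 (c + (⟪maxOperator q f, g⟫_ℂ - ⟪(f : L2), maxOperator q g⟫_ℂ))) := by
  have hf := rep_inDmax (q := q) f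
  have hg := rep_inDmax (q := q) g
  rw [inner_eq_integral_of_ae_eq (maxOperator_ae f hf (rep_ae (q := q) f)) (rep_ae (q := q) g),
    inner_eq_integral_of_ae_eq (rep_ae (q := q) f) (maxOperator_ae g hg (rep_ae (q := q) g))]
  exact hf.exists_tendsto_bracket hg

/-- The boundary value `f ↦ lim [w, f]_x` along `l`, where `l` stands for one of the two ends of
the line. -/
noncomputable def boundaryValue (w : ℝ → ℂ) (l : Filter ℝ) [l.NeBot]
    (hl : ∀ f : (maxOperator q).domain, ∃ c, Tendsto (bracket w (rep (q := q) f)) l (𝓝 c)) :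
    (maxOperator q).domain →ₗ[ℂ] ℂ where
  toFun f := limUnder l (bracket w (rep (q := q) f))
  map_add' f g := by
    rw [show rep (q := q) (f + g) = _ from rep_add (q := q) f g,
      bracket_add w (rep_inDmax (q := q) f).regular (rep_inDmax (q := q) g).regular]
    exact ((tendsto_nhds_limUnder (hl f)).add (tendsto_nhds_limUnder (hl g))).limUnder_eq
  map_smul' c f := by
    rw [show rep (q := q) (c • f) = _ from rep_smul (q := q) c f,
      bracket_smul w c (rep_inDmax (q := q) f).regular]
    exact ((tendsto_nhds_limUnder (hl f)).const_mul c).limUnder_eq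

theorem InDmax.exists_tendsto_bracket_atBot (hw : InDmax q w) (f : (maxOperator q).domain) :
    ∃ c, Tendsto (bracket w (rep (q := q) f)) atBot (𝓝 c) :=
  (hw.exists_tendsto_bracket (rep_inDmax (q := q) f)).imp fun _ => And.left

theorem InDmax.exists_tendsto_bracket_atTop (hw : InDmax q w) (f : (maxOperator q).domain) :
    ∃ c, Tendsto (bracket w (rep (q := q) f)) atTop (𝓝 c) :=
  (hw.exists_tendsto_bracket (rep_inDmax (q := q) f)).elim fun _ h => ⟨_, h.2⟩

/-- The form `(a, c) ↦ a̅₁ c₂ - a̅₂ c₁` on the boundary values at one end of the line. -/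
noncomputable def symplecticForm : ℂ × ℂ →ₗ⋆[ℂ] ℂ × ℂ →ₗ[ℂ] ℂ :=
  LinearMap.mk₂'ₛₗ _ _ (fun a c => conj a.1 * c.2 - conj a.2 * c.1)
    (fun a a' c => by simp only [Prod.fst_add, Prod.snd_add, map_add]; ring)
    (fun t a c => by simp only [Prod.smul_fst, Prod.smul_snd, smul_eq_mul, map_mul]; ring)
    (fun a c c' => by simp only [Prod.fst_add, Prod.snd_add]; ring)
    (fun t a c => by simp only [Prod.smul_fst, Prod.smul_snd, smul_eq_mul, RingHom.id_apply]; ring)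

theorem symplecticForm_apply (a c : ℂ × ℂ) :
    symplecticForm a c = conj a.1 * c.2 - conj a.2 * c.1 :=
  rfl

/-- The form of Green's formula: the contribution of `+∞` minus that of `-∞`. -/
noncomputable def boundaryForm :
    (ℂ × ℂ) × (ℂ × ℂ) →ₗ⋆[ℂ] (ℂ × ℂ) × (ℂ × ℂ) →ₗ[ℂ] ℂ :=
  LinearMap.mk₂'ₛₗ _ _ (fun z z' => symplecticForm z.2 z'.2 - symplecticForm z.1 z'.1)
    (fun _ _ _ => by simp only [Prod.fst_add, Prod.snd_add, map_add, LinearMap.add_apply]; ring)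
    (fun _ _ _ => by
      simp only [Prod.smul_fst, Prod.smul_snd, map_smulₛₗ, LinearMap.smul_apply, smul_sub])
    (fun _ _ _ => by simp only [Prod.fst_add, Prod.snd_add, map_add]; ring)
    (fun _ _ _ => by
      simp only [Prod.smul_fst, Prod.smul_snd, map_smul, RingHom.id_apply, smul_sub])

theorem boundaryForm_apply (z z' : (ℂ × ℂ) × (ℂ × ℂ)) :
    boundaryForm z z' = symplecticForm z.2 z'.2 - symplecticForm z.1 z'.1 :=
  rfl

end BoundaryValues

namespace IsFundamentalPair

variable {q : ℝ → ℝ} {w₁ w₂ : ℝ → ℂ} (hw : IsFundamentalPair q w₁ w₂)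

/-- The boundary values `((α₁ f, α₂ f), (β₁ f, β₂ f))` at `-∞` and at `+∞`. -/
noncomputable def boundaryMap : (maxOperator q).domain →ₗ[ℂ] (ℂ × ℂ) × (ℂ × ℂ) :=
  ((boundaryValue w₁ atBot hw.dmax₁.exists_tendsto_bracket_atBot).prod
    (boundaryValue w₂ atBot hw.dmax₂.exists_tendsto_bracket_atBot)).prod
  ((boundaryValue w₁ atTop hw.dmax₁.exists_tendsto_bracket_atTop).prod
    (boundaryValue w₂ atTop hw.dmax₂.exists_tendsto_bracket_atTop))

theorem hasBoundaryValues_rep (f : (maxOperator q).domain) :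
    HasBoundaryValues w₁ w₂ (rep (q := q) f) (hw.boundaryMap f).1.1 (hw.boundaryMap f).1.2
      (hw.boundaryMap f).2.1 (hw.boundaryMap f).2.2 where
  α₁ := tendsto_nhds_limUnder (hw.dmax₁.exists_tendsto_bracket_atBot f)
  α₂ := tendsto_nhds_limUnder (hw.dmax₂.exists_tendsto_bracket_atBot f)
  β₁ := tendsto_nhds_limUnder (hw.dmax₁.exists_tendsto_bracket_atTop f)
  β₂ := tendsto_nhds_limUnder (hw.dmax₂.exists_tendsto_bracket_atTop f)

theorem boundaryMap_eq {f : (maxOperator q).domain} {y : ℝ → ℂ} {a₁ a₂ b₁ b₂ : ℂ}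
    (hy : IsRegular y) (hf : (f : L2) =ᵐ[volume] y) (h : HasBoundaryValues w₁ w₂ y a₁ a₂ b₁ b₂) :
    hw.boundaryMap f = ((a₁, a₂), (b₁, b₂)) := by
  rw [← rep_eq (q := q) f hy hf] at h
  exact Prod.ext (Prod.ext h.α₁.limUnder_eq h.α₂.limUnder_eq)
    (Prod.ext h.β₁.limUnder_eq h.β₂.limUnder_eq)

include hw in
theorem tendsto_bracket_rep {l : Filter ℝ} {f g : (maxOperator q).domain} {a c : ℂ × ℂ}
    (hf₁ : Tendsto (bracket w₁ (rep (q := q) f)) l (𝓝 a.1))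
    (hf₂ : Tendsto (bracket w₂ (rep (q := q) f)) l (𝓝 a.2))
    (hg₁ : Tendsto (bracket w₁ (rep (q := q) g)) l (𝓝 c.1))
    (hg₂ : Tendsto (bracket w₂ (rep (q := q) g)) l (𝓝 c.2)) :
    Tendsto (bracket (rep (q := q) f) (rep (q := q) g)) l (𝓝 (symplecticForm a c)) := by
  rw [funext (hw.bracket_eq _ _)]
  exact (hf₁.star.mul hg₂).sub (hf₂.star.mul hg₁)

theorem green (f g : (maxOperator q).domain) :
    ⟪maxOperator q f, g⟫_ℂ - ⟪(f : L2), maxOperator q g⟫_ℂ =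
      boundaryForm (hw.boundaryMap f) (hw.boundaryMap g) := by
  obtain ⟨c, hbot, htop⟩ := exists_tendsto_bracket_rep f g
  have hf := hw.hasBoundaryValues_rep f
  have hg := hw.hasBoundaryValues_rep g
  have hc := tendsto_nhds_unique hbot (hw.tendsto_bracket_rep hf.α₁ hf.α₂ hg.α₁ hg.α₂)
  have hd := tendsto_nhds_unique htop (hw.tendsto_bracket_rep hf.β₁ hf.β₂ hg.β₁ hg.β₂)
  rw [boundaryForm_apply, ← hc, ← hd, add_sub_cancel_left]

theorem exists_maxOperator_eq (u : L2) (a : ℂ × ℂ) :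
    ∃ f, maxOperator q f = u ∧ hw.boundaryMap f =
      (a, (a.1 - ⟪(hw.dmax₁.toDomain : L2), u⟫_ℂ, a.2 - ⟪(hw.dmax₂.toDomain : L2), u⟫_ℂ)) := by
  obtain ⟨y, hy, hτ, hbv⟩ := hw.exists_tau_eq (Lp.memLp u) a.1 a.2
  refine ⟨hy.toDomain, Lp.ext ((maxOperator_ae _ hy hy.coe_toDomain_ae_eq).trans hτ), ?_⟩
  rw [hw.boundaryMap_eq hy.regular hy.coe_toDomain_ae_eq hbv,
    inner_eq_integral_of_ae_eq hw.dmax₁.coe_toDomain_ae_eq EventuallyEq.rfl,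
    inner_eq_integral_of_ae_eq hw.dmax₂.coe_toDomain_ae_eq EventuallyEq.rfl]
  simp only [congrFun hw.conj₁, congrFun hw.conj₂]

include hw in
theorem inner_toDomain_eq_zero :
    ⟪(hw.dmax₁.toDomain : L2), (hw.dmax₂.toDomain : L2)⟫_ℂ = 0 := by
  rw [inner_eq_integral_of_ae_eq hw.dmax₁.coe_toDomain_ae_eq hw.dmax₂.coe_toDomain_ae_eq,
    ← self_eq_neg, ← integral_neg, ← integral_neg_eq_self]
  simp only [hw.odd₁ _, hw.even₂ _, map_neg, neg_mul]

include hw in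
theorem ne_zero₁ : w₁ ≠ 0 := fun h => by
  simpa [bracket, h] using hw.bracket_eq_one 0

include hw in
theorem ne_zero₂ : w₂ ≠ 0 := fun h => by
  simpa [bracket, h] using hw.bracket_eq_one 0

theorem boundaryMap_surjective : Function.Surjective hw.boundaryMap := by
  rintro ⟨a, b⟩
  have hvariation := fun u => hw.exists_maxOperator_eq u a
  set W₁ : L2 := (hw.dmax₁.toDomain : L2)
  set W₂ : L2 := (hw.dmax₂.toDomain : L2)
  have h₁ : ⟪W₁, W₁⟫_ℂ ≠ 0 := inner_self_ne_zero.2 (hw.dmax₁.toDomain_ne_zero hw.ne_zero₁)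
  have h₂ : ⟪W₂, W₂⟫_ℂ ≠ 0 := inner_self_ne_zero.2 (hw.dmax₂.toDomain_ne_zero hw.ne_zero₂)
  have h₁₂ : ⟪W₁, W₂⟫_ℂ = 0 := hw.inner_toDomain_eq_zero
  obtain ⟨f, -, hf⟩ := hvariation
    (((a.1 - b.1) / ⟪W₁, W₁⟫_ℂ) • W₁ + ((a.2 - b.2) / ⟪W₂, W₂⟫_ℂ) • W₂)
  refine ⟨f, hf.trans ?_⟩
  simp only [inner_add_right, inner_smul_right, inner_eq_zero_symm.1 h₁₂, h₁₂]
  rw [div_mul_cancel₀ _ h₁, div_mul_cancel₀ _ h₂, mul_zero, mul_zero, add_zero, zero_add,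
    sub_sub_cancel, sub_sub_cancel]

/-- The boundary system of the maximal operator given by a fundamental pair. -/
noncomputable def boundarySystem : BoundarySystem (maxOperator q) ((ℂ × ℂ) × (ℂ × ℂ)) where
  toMap := hw.boundaryMap
  form := boundaryForm
  surjective := hw.boundaryMap_surjective
  green := hw.green
  maximal v h hvh := by
    set W₁ := hw.dmax₁.toDomain
    set W₂ := hw.dmax₂.toDomain
    have : FiniteDimensional ℂ (Submodule.span ℂ {(W₁ : L2), (W₂ : L2)}) :=
      FiniteDimensional.span_of_finite ℂ (Set.toFinite _)
    refine BoundarySystem.maximal_of_ker (N := Submodule.span ℂ {(W₁ : L2), (W₂ : L2)}) hw.green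
      (fun u => (hw.exists_maxOperator_eq u 0).imp fun _ => And.left) (fun n hn => ?_)
      (fun u hu => ?_) hvh
    · obtain ⟨s, t, rfl⟩ := Submodule.mem_span_pair.1 hn
      refine ⟨(s • W₁ + t • W₂).2, (LinearPMap.map_add _ (s • W₁) (t • W₂)).trans ?_⟩
      rw [LinearPMap.map_smul, LinearPMap.map_smul, hw.sol₁.maxOperator_toDomain,
        hw.sol₂.maxOperator_toDomain, smul_zero, smul_zero, add_zero]
    · obtain ⟨f, hf, hΓ⟩ := hw.exists_maxOperator_eq u 0
      rw [Submodule.mem_orthogonal] at hu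
      refine ⟨f, hΓ.trans ?_, hf⟩
      rw [hu W₁ (Submodule.subset_span (by simp)), hu W₂ (Submodule.subset_span (by simp))]
      simp

end IsFundamentalPair

/-! ### Separated boundary conditions as lines -/

section BoundaryLine

variable {ξ η : ℂ} {α β : ℝ}

/-- The boundary condition `z₁ ξ cos α - z₂ sin α = 0` on the boundary values at one end of the
line. -/
noncomputable def boundaryLine (ξ : ℂ) (α : ℝ) : Submodule ℂ (ℂ × ℂ) :=
  LinearMap.ker ((ξ * Real.cos α) • LinearMap.fst ℂ ℂ ℂ - (Real.sin α : ℂ) • LinearMap.snd ℂ ℂ ℂ)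

theorem mem_boundaryLine_iff {z : ℂ × ℂ} :
    z ∈ boundaryLine ξ α ↔ z.1 * ξ * (Real.cos α : ℂ) - z.2 * (Real.sin α : ℂ) = 0 := by
  simp only [boundaryLine, LinearMap.mem_ker, LinearMap.sub_apply, LinearMap.smul_apply,
    LinearMap.fst_apply, LinearMap.snd_apply, smul_eq_mul]
  ring_nf

theorem boundaryLine_eq_span (hξ : ξ ≠ 0) (α : ℝ) :
    boundaryLine ξ α = Submodule.span ℂ {((Real.sin α : ℂ), ξ * (Real.cos α : ℂ))} := by
  have hsc : (Real.sin α : ℂ) * Real.sin α + Real.cos α * Real.cos α = 1 := by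
    exact_mod_cast (by simpa only [sq] using Real.sin_sq_add_cos_sq α)
  ext z
  rw [Submodule.mem_span_singleton, mem_boundaryLine_iff]
  constructor
  · intro hz
    refine ⟨z.1 * Real.sin α + ξ⁻¹ * z.2 * Real.cos α, Prod.ext ?_ ?_⟩ <;>
      simp only [Prod.smul_fst, Prod.smul_snd, smul_eq_mul] <;> field_simp
    · linear_combination z.1 * ξ * hsc - Real.cos α * hz
    · linear_combination z.2 * hsc + Real.sin α * hz
  · rintro ⟨t, rfl⟩
    simp only [Prod.smul_fst, Prod.smul_snd, smul_eq_mul]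
    ring

theorem boundaryLine_le_iff (hξ : ξ ≠ 0) : boundaryLine ξ α ≤ boundaryLine η β ↔
    ξ * Real.cos α * Real.sin β = η * Real.cos β * Real.sin α := by
  rw [boundaryLine_eq_span hξ, Submodule.span_singleton_le_iff_mem, mem_boundaryLine_iff,
    sub_eq_zero, eq_comm, mul_comm (Real.sin α : ℂ), mul_right_comm η]

theorem boundaryLine_eq_iff (hξ : ξ ≠ 0) (hη : η ≠ 0) : boundaryLine ξ α = boundaryLine η β ↔
    ξ * Real.cos α * Real.sin β = η * Real.cos β * Real.sin α := by
  rw [le_antisymm_iff, boundaryLine_le_iff hξ, boundaryLine_le_iff hη]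
  exact ⟨And.left, fun h => ⟨h, h.symm⟩⟩

theorem boundaryLine_le_iff_eq (hξ : ξ ≠ 0) (hη : η ≠ 0) :
    boundaryLine ξ α ≤ boundaryLine η β ↔ boundaryLine ξ α = boundaryLine η β := by
  rw [boundaryLine_le_iff hξ, boundaryLine_eq_iff hξ hη]

theorem boundaryLine_eq_conj_neg_comm (hξ : ξ ≠ 0) (hη : η ≠ 0) :
    boundaryLine ξ α = boundaryLine (conj η) (-β) ↔
      boundaryLine η β = boundaryLine (conj ξ) (-α) := by
  have hξ' : conj ξ ≠ 0 := (map_ne_zero _).2 hξ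
  have hη' : conj η ≠ 0 := (map_ne_zero _).2 hη
  rw [boundaryLine_eq_iff hξ hη', boundaryLine_eq_iff hη hξ', ← (starRingEnd ℂ).injective.eq_iff]
  simp only [Real.cos_neg, Real.sin_neg, map_mul, Complex.conj_conj, Complex.conj_ofReal,
    Complex.ofReal_neg, mul_neg, map_neg]
  exact neg_eq_iff_eq_neg.trans eq_comm

theorem boundaryLine_one_eq_one_neg_iff :
    boundaryLine 1 α = boundaryLine 1 (-β) ↔ ∃ k : ℤ, α + β = k * Real.pi := by
  have hsin : Real.sin (α + β) = 0 ↔ ∃ k : ℤ, α + β = k * Real.pi := by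
    rw [Real.sin_eq_zero_iff]
    exact exists_congr fun _ => eq_comm
  rw [← hsin, boundaryLine_eq_iff one_ne_zero one_ne_zero, Real.sin_add]
  norm_cast
  rw [Real.sin_neg, Real.cos_neg]
  constructor <;> intro h <;> linarith

theorem neg_snd_mem_boundaryLine_iff {z : ℂ × ℂ} :
    (z.1, -z.2) ∈ boundaryLine ξ α ↔ z ∈ boundaryLine ξ (-α) := by
  simp only [mem_boundaryLine_iff, Real.cos_neg, Real.sin_neg, Complex.ofReal_neg, mul_neg, neg_mul]

theorem conj_mem_boundaryLine_iff {z : ℂ × ℂ} :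
    (conj z.1, conj z.2) ∈ boundaryLine ξ α ↔ z ∈ boundaryLine (conj ξ) α := by
  rw [mem_boundaryLine_iff, mem_boundaryLine_iff, ← (starRingEnd ℂ).injective.eq_iff]
  simp only [map_sub, map_mul, Complex.conj_conj, Complex.conj_ofReal, map_zero]

theorem orthogonalBilin_boundaryLine (hξ : ξ ≠ 0) (α : ℝ) :
    (boundaryLine ξ α).orthogonalBilin symplecticForm = boundaryLine (conj ξ) α := by
  ext z
  rw [boundaryLine_eq_span hξ, Submodule.mem_orthogonalBilin_iff, mem_boundaryLine_iff]
  trans symplecticForm (Real.sin α, ξ * Real.cos α) z = 0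
  · refine ⟨fun h => h _ (Submodule.mem_span_singleton_self _), fun h v hv => ?_⟩
    obtain ⟨t, rfl⟩ := Submodule.mem_span_singleton.1 hv
    rw [map_smulₛₗ, LinearMap.smul_apply, h, smul_zero]
  · rw [symplecticForm_apply, map_mul, Complex.conj_ofReal, Complex.conj_ofReal, ← neg_eq_zero]
    ring_nf

theorem orthogonalBilin_prod (L M : Submodule ℂ (ℂ × ℂ)) :
    (L.prod M).orthogonalBilin boundaryForm =
      (L.orthogonalBilin symplecticForm).prod (M.orthogonalBilin symplecticForm) := by
  ext z
  simp only [Submodule.mem_orthogonalBilin_iff, Submodule.mem_prod, boundaryForm_apply]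
  refine ⟨fun h => ⟨fun a ha => ?_, fun b hb => ?_⟩, fun h z' hz' => ?_⟩
  · simpa using h (a, 0) ⟨ha, M.zero_mem⟩
  · simpa using h (0, b) ⟨L.zero_mem, hb⟩
  · rw [h.1 _ hz'.1, h.2 _ hz'.2, sub_zero]

theorem isNormalized_one (α : ℝ) : IsNormalized 1 α :=
  ⟨by norm_num, fun _ => rfl⟩

theorem boundaryLine_conj_eq_iff_of_isNormalized (hξ : ‖ξ‖ = 1) (h : IsNormalized ξ α) :
    boundaryLine (conj ξ) α = boundaryLine ξ α ↔ ξ = 1 := by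
  have hξ₀ : ξ ≠ 0 := norm_ne_zero_iff.1 (hξ ▸ one_ne_zero)
  refine ⟨fun heq => ?_, fun h₁ => by rw [h₁, map_one]⟩
  rw [boundaryLine_eq_iff ((map_ne_zero _).2 hξ₀) hξ₀, mul_assoc, mul_assoc, mul_eq_mul_right_iff]
    at heq
  rcases heq with hreal | hsc
  · have hsq : ξ * ξ = 1 := by
      have := Complex.mul_conj' ξ
      rw [hreal, hξ] at this
      simpa using this
    exact (mul_self_eq_one_iff.1 hsq).resolve_right h.1
  · refine h.2 ?_
    rw [mul_comm]
    exact_mod_cast hsc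

theorem exists_isNormalized (hξ : ‖ξ‖ = 1) (hα : α ∈ Set.Ico 0 (2 * Real.pi)) :
    ∃ (ξ' : ℂ) (α' : ℝ), ‖ξ'‖ = 1 ∧ α' ∈ Set.Ico 0 (2 * Real.pi) ∧ IsNormalized ξ' α' ∧
      boundaryLine ξ α = boundaryLine ξ' α' := by
  have hξ₀ : ξ ≠ 0 := norm_ne_zero_iff.1 (hξ ▸ one_ne_zero)
  by_cases hsc : Real.sin α * Real.cos α = 0
  · refine ⟨1, α, norm_one, hα, isNormalized_one α, ?_⟩
    rw [boundaryLine_eq_iff hξ₀ one_ne_zero]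
    rcases mul_eq_zero.1 hsc with h | h <;> simp [h]
  · rcases eq_or_ne ξ (-1) with rfl | hξ₁
    · have hα₀ : α ≠ 0 := by
        rintro rfl
        simp at hsc
      have hpos := lt_of_le_of_ne hα.1 hα₀.symm
      refine ⟨1, 2 * Real.pi - α, norm_one, ⟨by linarith [hα.2], by linarith⟩,
        isNormalized_one _, ?_⟩
      rw [boundaryLine_eq_iff hξ₀ one_ne_zero, Real.cos_two_pi_sub, Real.sin_two_pi_sub]
      push_cast
      ring
    · exact ⟨ξ, α, hξ, hα, ⟨hξ₁, fun h => absurd h hsc⟩, rfl⟩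

end BoundaryLine

namespace IsFundamentalPair

variable {q : ℝ → ℝ} {w₁ w₂ : ℝ → ℂ} (hw : IsFundamentalPair q w₁ w₂) {ξ ξ' η η' : ℂ}
  {α α' β β' : ℝ}

theorem separatedExtension_eq_restrict (ξ η : ℂ) (α β : ℝ) :
    separatedExtension q w₁ w₂ ξ η α β =
      hw.boundarySystem.restrict ((boundaryLine ξ α).prod (boundaryLine η β)) := by
  refine congrArg (maxOperator q).domRestrict (Submodule.ext fun f => ?_)
  simp only [Submodule.mem_map, Submodule.mem_comap, Submodule.subtype_apply, Submodule.mem_prod,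
    mem_boundaryLine_iff]
  constructor
  · rintro ⟨y, hy, hfy, a₁, a₂, b₁, b₂, hbv, hα, hβ⟩
    refine ⟨⟨f, y, hy, hfy⟩, ?_, rfl⟩
    rw [show hw.boundarySystem.toMap _ = _ from hw.boundaryMap_eq hy.regular hfy hbv]
    exact ⟨hα, hβ⟩
  · rintro ⟨f, ⟨hα, hβ⟩, rfl⟩
    exact ⟨rep (q := q) f, rep_inDmax (q := q) f, rep_ae (q := q) f, _, _, _, _,
      hw.hasBoundaryValues_rep f, hα, hβ⟩

include hw

theorem separatedExtension_domain_le_iff (hξ : ξ ≠ 0) (hη : η ≠ 0) (hξ' : ξ' ≠ 0) (hη' : η' ≠ 0) :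
    (separatedExtension q w₁ w₂ ξ η α β).domain ≤ (separatedExtension q w₁ w₂ ξ' η' α' β').domain ↔
      boundaryLine ξ α = boundaryLine ξ' α' ∧ boundaryLine η β = boundaryLine η' β' := by
  rw [hw.separatedExtension_eq_restrict, hw.separatedExtension_eq_restrict,
    hw.boundarySystem.restrict_domain_le_iff, Submodule.prod_le_iff,
    Submodule.map_le_iff_le_comap, Submodule.map_le_iff_le_comap, Submodule.prod_comap_inl,
    Submodule.prod_comap_inr, boundaryLine_le_iff_eq hξ hξ', boundaryLine_le_iff_eq hη hη']

theorem separatedExtension_eq_iff (hξ : ξ ≠ 0) (hη : η ≠ 0) (hξ' : ξ' ≠ 0) (hη' : η' ≠ 0) :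
    separatedExtension q w₁ w₂ ξ η α β = separatedExtension q w₁ w₂ ξ' η' α' β' ↔
      boundaryLine ξ α = boundaryLine ξ' α' ∧ boundaryLine η β = boundaryLine η' β' := by
  refine ⟨fun h => (hw.separatedExtension_domain_le_iff hξ hη hξ' hη').1 (by rw [h]), fun h => ?_⟩
  rw [hw.separatedExtension_eq_restrict, hw.separatedExtension_eq_restrict, h.1, h.2]

theorem mem_separatedExtension_domain_iff {f : L2} :
    f ∈ (separatedExtension q w₁ w₂ ξ η α β).domain ↔ ∃ hf : f ∈ (maxOperator q).domain,
      (hw.boundaryMap ⟨f, hf⟩).1 ∈ boundaryLine ξ α ∧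
        (hw.boundaryMap ⟨f, hf⟩).2 ∈ boundaryLine η β := by
  rw [hw.separatedExtension_eq_restrict]
  exact hw.boundarySystem.mem_restrict_domain_iff

theorem adjoint_separatedExtension (hξ : ξ ≠ 0) (hη : η ≠ 0) (α β : ℝ) :
    (separatedExtension q w₁ w₂ ξ η α β).adjoint =
      separatedExtension q w₁ w₂ (conj ξ) (conj η) α β := by
  rw [hw.separatedExtension_eq_restrict, hw.separatedExtension_eq_restrict,
    hw.boundarySystem.adjoint_restrict, ← orthogonalBilin_boundaryLine hξ,
    ← orthogonalBilin_boundaryLine hη]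
  exact congrArg _ (orthogonalBilin_prod _ _)

theorem isClosedDense_separatedExtension (hξ : ξ ≠ 0) (hη : η ≠ 0) (α β : ℝ) :
    IsClosedDense (separatedExtension q w₁ w₂ ξ η α β) := by
  have hdense (ξ η : ℂ) : Dense ((separatedExtension q w₁ w₂ ξ η α β).domain : Set L2) := by
    rw [hw.separatedExtension_eq_restrict]
    exact hw.boundarySystem.dense_restrict_domain
  refine ⟨?_, hdense ξ η⟩
  have hclosed := LinearPMap.adjoint_isClosed (hdense (conj ξ) (conj η))
  rwa [hw.adjoint_separatedExtension ((map_ne_zero _).2 hξ) ((map_ne_zero _).2 hη),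
    Complex.conj_conj, Complex.conj_conj] at hclosed

theorem isSelfAdjoint_separatedExtension_iff (hξ : ξ ≠ 0) (hη : η ≠ 0) :
    IsSelfAdjoint (separatedExtension q w₁ w₂ ξ η α β) ↔
      boundaryLine (conj ξ) α = boundaryLine ξ α ∧ boundaryLine (conj η) β = boundaryLine η β := by
  rw [LinearPMap.isSelfAdjoint_def, hw.adjoint_separatedExtension hξ hη,
    hw.separatedExtension_eq_iff ((map_ne_zero _).2 hξ) ((map_ne_zero _).2 hη) hξ hη]

end IsFundamentalPair

/-! ### Parity and time reversal -/

section Symmetries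

variable {q : ℝ → ℝ} {y : ℝ → ℂ}

theorem tau_reflect (hq : Function.Even q) (y : ℝ → ℂ) :
    tau q (fun x => y (-x)) = fun x => tau q y (-x) := by
  funext x
  simp only [tau, deriv_reflect, deriv.fun_neg, deriv_comp_neg, neg_neg, hq x]

theorem tau_conj (q : ℝ → ℝ) (y : ℝ → ℂ) :
    tau q (fun x => conj (y x)) = fun x => conj (tau q y x) := by
  funext x
  simp only [tau, deriv_conj, map_sub, map_neg, map_mul, Complex.conj_ofReal]

theorem InDmax.reflect (hq : Function.Even q) (hy : InDmax q y) : InDmax q fun x => y (-x) where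
  regular :=
    { differentiable := hy.regular.differentiable.comp differentiable_neg
      ac := hy.regular.ac.comp_neg
      ac_deriv := by
        rw [deriv_reflect]
        exact hy.regular.ac_deriv.comp_neg.neg }
  memLp := hy.memLp.comp_measurePreserving (Measure.measurePreserving_neg volume)
  memLp_tau := by
    rw [tau_reflect hq]
    exact hy.memLp_tau.comp_measurePreserving (Measure.measurePreserving_neg volume)

theorem InDmax.conj (hy : InDmax q y) : InDmax q fun x => conj (y x) where
  regular :=
    { differentiable := hy.regular.differentiable.star
      ac := hy.regular.ac.conj
      ac_deriv := by
        rw [deriv_conj]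
        exact hy.regular.ac_deriv.conj }
  memLp := hy.memLp.star
  memLp_tau := by
    rw [tau_conj]
    exact hy.memLp_tau.star

theorem parity_ae_of_ae {f : L2} (h : f =ᵐ[volume] y) : parity f =ᵐ[volume] fun x => y (-x) :=
  (parity_ae f).trans ((Measure.measurePreserving_neg volume).quasiMeasurePreserving.ae_eq_comp h)

theorem timeReversal_ae_of_ae {f : L2} (h : f =ᵐ[volume] y) :
    timeReversal f =ᵐ[volume] fun x => conj (y x) :=
  (timeReversal_ae f).trans (h.fun_comp conj)

theorem parity_parity (f : L2) : parity (parity f) = f :=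
  Lp.ext ((parity_ae_of_ae (parity_ae f)).trans (by simp only [neg_neg]; rfl))

theorem exists_maxOperator_parity (hq : Function.Even q) (f : (maxOperator q).domain) :
    ∃ h : parity (f : L2) ∈ (maxOperator q).domain,
      maxOperator q ⟨parity (f : L2), h⟩ = parity (maxOperator q f) := by
  have hy := (rep_inDmax (q := q) f).reflect hq
  have hf := parity_ae_of_ae (rep_ae (q := q) f)
  refine ⟨⟨_, hy, hf⟩, Lp.ext ((maxOperator_ae _ hy hf).trans ?_)⟩
  rw [tau_reflect hq]
  exact (parity_ae_of_ae (maxOperator_ae f (rep_inDmax (q := q) f) (rep_ae (q := q) f))).symm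

theorem exists_maxOperator_timeReversal (f : (maxOperator q).domain) :
    ∃ h : timeReversal (f : L2) ∈ (maxOperator q).domain,
      maxOperator q ⟨timeReversal (f : L2), h⟩ = timeReversal (maxOperator q f) := by
  have hy := (rep_inDmax (q := q) f).conj
  have hf := timeReversal_ae_of_ae (rep_ae (q := q) f)
  refine ⟨⟨_, hy, hf⟩, Lp.ext ((maxOperator_ae _ hy hf).trans ?_)⟩
  rw [tau_conj]
  exact (timeReversal_ae_of_ae (maxOperator_ae f (rep_inDmax (q := q) f) (rep_ae (q := q) f))).symm

end Symmetries

namespace IsFundamentalPair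

variable {q : ℝ → ℝ} {w₁ w₂ : ℝ → ℂ} (hw : IsFundamentalPair q w₁ w₂)
include hw

theorem bracket_reflect₁ (y : ℝ → ℂ) :
    bracket w₁ (fun x => y (-x)) = fun x => bracket w₁ y (-x) := by
  have hw₁ : w₁ = fun x => -w₁ (-x) := funext fun x => by rw [hw.odd₁, neg_neg]
  conv_lhs => rw [hw₁]
  rw [bracket_neg_left, bracket_reflect]
  simp only [neg_neg]

theorem bracket_reflect₂ (y : ℝ → ℂ) :
    bracket w₂ (fun x => y (-x)) = fun x => -bracket w₂ y (-x) := by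
  conv_lhs => rw [← funext hw.even₂]
  exact bracket_reflect w₂ y

theorem bracket_conj₁ (y : ℝ → ℂ) :
    bracket w₁ (fun x => conj (y x)) = fun x => conj (bracket w₁ y x) := by
  simpa only [congrFun hw.conj₁] using bracket_conj w₁ y

theorem bracket_conj₂ (y : ℝ → ℂ) :
    bracket w₂ (fun x => conj (y x)) = fun x => conj (bracket w₂ y x) := by
  simpa only [congrFun hw.conj₂] using bracket_conj w₂ y

theorem hasBoundaryValues_reflect {y : ℝ → ℂ} {a₁ a₂ b₁ b₂ : ℂ}
    (h : HasBoundaryValues w₁ w₂ y a₁ a₂ b₁ b₂) :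
    HasBoundaryValues w₁ w₂ (fun x => y (-x)) b₁ (-b₂) a₁ (-a₂) := by
  constructor <;> simp only [hw.bracket_reflect₁, hw.bracket_reflect₂]
  exacts [h.β₁.comp tendsto_neg_atBot_atTop, (h.β₂.comp tendsto_neg_atBot_atTop).neg,
    h.α₁.comp tendsto_neg_atTop_atBot, (h.α₂.comp tendsto_neg_atTop_atBot).neg]

theorem hasBoundaryValues_conj {y : ℝ → ℂ} {a₁ a₂ b₁ b₂ : ℂ}
    (h : HasBoundaryValues w₁ w₂ y a₁ a₂ b₁ b₂) :
    HasBoundaryValues w₁ w₂ (fun x => conj (y x)) (conj a₁) (conj a₂) (conj b₁) (conj b₂) := by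
  constructor <;> simp only [hw.bracket_conj₁, hw.bracket_conj₂]
  exacts [h.α₁.star, h.α₂.star, h.β₁.star, h.β₂.star]

theorem boundaryMap_parity (hq : Function.Even q) (f : (maxOperator q).domain)
    (h : parity (f : L2) ∈ (maxOperator q).domain) :
    hw.boundaryMap ⟨parity (f : L2), h⟩ =
      (((hw.boundaryMap f).2.1, -(hw.boundaryMap f).2.2),
        ((hw.boundaryMap f).1.1, -(hw.boundaryMap f).1.2)) :=
  hw.boundaryMap_eq ((rep_inDmax (q := q) f).reflect hq).regular
    (parity_ae_of_ae (rep_ae (q := q) f))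
    (hw.hasBoundaryValues_reflect (hw.hasBoundaryValues_rep f))

theorem boundaryMap_timeReversal (f : (maxOperator q).domain)
    (h : timeReversal (f : L2) ∈ (maxOperator q).domain) :
    hw.boundaryMap ⟨timeReversal (f : L2), h⟩ =
      ((conj (hw.boundaryMap f).1.1, conj (hw.boundaryMap f).1.2),
        (conj (hw.boundaryMap f).2.1, conj (hw.boundaryMap f).2.2)) :=
  hw.boundaryMap_eq (rep_inDmax (q := q) f).conj.regular
    (timeReversal_ae_of_ae (rep_ae (q := q) f))
    (hw.hasBoundaryValues_conj (hw.hasBoundaryValues_rep f))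

end IsFundamentalPair

/-! ### Symmetries of the separated extensions -/

section

variable {q : ℝ → ℝ} {w₁ w₂ : ℝ → ℂ} {ξ ξ' η η' : ℂ} {α α' β β' : ℝ}

theorem separatedExtension_apply {f : (separatedExtension q w₁ w₂ ξ η α β).domain}
    {g : (maxOperator q).domain} (h : (f : L2) = g) :
    separatedExtension q w₁ w₂ ξ η α β f = maxOperator q g :=
  LinearPMap.domRestrict_apply h

theorem separatedExtension_parity (hq : Function.Even q)
    {f : (separatedExtension q w₁ w₂ ξ η α β).domain}
    {g : (separatedExtension q w₁ w₂ ξ' η' α' β').domain} (hg : (g : L2) = parity f) :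
    separatedExtension q w₁ w₂ ξ' η' α' β' g =
      parity (separatedExtension q w₁ w₂ ξ η α β f) := by
  obtain ⟨h, hP⟩ := exists_maxOperator_parity hq ⟨f, f.2.2⟩
  rw [separatedExtension_apply (g := ⟨parity f, h⟩) hg,
    separatedExtension_apply (g := ⟨f, f.2.2⟩) rfl, ← hP]

theorem separatedExtension_timeReversal {f : (separatedExtension q w₁ w₂ ξ η α β).domain}
    {g : (separatedExtension q w₁ w₂ ξ' η' α' β').domain} (hg : (g : L2) = timeReversal f) :
    separatedExtension q w₁ w₂ ξ' η' α' β' g =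
      timeReversal (separatedExtension q w₁ w₂ ξ η α β f) := by
  obtain ⟨h, hT⟩ := exists_maxOperator_timeReversal ⟨f, f.2.2⟩
  rw [separatedExtension_apply (g := ⟨timeReversal f, h⟩) hg,
    separatedExtension_apply (g := ⟨f, f.2.2⟩) rfl, ← hT]

end

namespace IsFundamentalPair

variable {q : ℝ → ℝ} {w₁ w₂ : ℝ → ℂ} (hw : IsFundamentalPair q w₁ w₂) {ξ η : ℂ} {α β : ℝ}
include hw

theorem parity_mem_separatedExtension_domain (hq : Function.Even q) {f : L2}
    (hf : f ∈ (separatedExtension q w₁ w₂ η ξ (-β) (-α)).domain) :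
    parity f ∈ (separatedExtension q w₁ w₂ ξ η α β).domain := by
  obtain ⟨hfA, hbot, htop⟩ := hw.mem_separatedExtension_domain_iff.1 hf
  obtain ⟨hPf, -⟩ := exists_maxOperator_parity hq ⟨f, hfA⟩
  refine hw.mem_separatedExtension_domain_iff.2 ⟨hPf, ?_⟩
  rw [hw.boundaryMap_parity hq ⟨f, hfA⟩]
  exact ⟨neg_snd_mem_boundaryLine_iff.2 htop, neg_snd_mem_boundaryLine_iff.2 hbot⟩

theorem parity_mem_separatedExtension_domain_iff (hq : Function.Even q) {f : L2} :
    parity f ∈ (separatedExtension q w₁ w₂ ξ η α β).domain ↔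
      f ∈ (separatedExtension q w₁ w₂ η ξ (-β) (-α)).domain := by
  refine ⟨fun h => ?_, hw.parity_mem_separatedExtension_domain hq⟩
  rw [← parity_parity f]
  exact hw.parity_mem_separatedExtension_domain hq (by rwa [neg_neg, neg_neg])

theorem timeReversal_mem_separatedExtension_domain {f : L2}
    (hf : f ∈ (separatedExtension q w₁ w₂ (conj ξ) (conj η) α β).domain) :
    timeReversal f ∈ (separatedExtension q w₁ w₂ ξ η α β).domain := by
  obtain ⟨hfA, hbot, htop⟩ := hw.mem_separatedExtension_domain_iff.1 hf
  obtain ⟨hTf, -⟩ := exists_maxOperator_timeReversal ⟨f, hfA⟩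
  refine hw.mem_separatedExtension_domain_iff.2 ⟨hTf, ?_⟩
  rw [hw.boundaryMap_timeReversal ⟨f, hfA⟩]
  exact ⟨conj_mem_boundaryLine_iff.2 hbot, conj_mem_boundaryLine_iff.2 htop⟩

theorem timeReversal_mem_separatedExtension_domain_iff {f : L2} :
    timeReversal f ∈ (separatedExtension q w₁ w₂ ξ η α β).domain ↔
      f ∈ (separatedExtension q w₁ w₂ (conj ξ) (conj η) α β).domain := by
  refine ⟨fun h => ?_, hw.timeReversal_mem_separatedExtension_domain⟩
  rw [← star_star f]
  exact hw.timeReversal_mem_separatedExtension_domain (by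
    rwa [Complex.conj_conj, Complex.conj_conj])

theorem isPTSymmetric_separatedExtension_iff (hq : Function.Even q) (hξ : ξ ≠ 0) (hη : η ≠ 0) :
    IsPTSymmetric (separatedExtension q w₁ w₂ ξ η α β) ↔
      boundaryLine ξ α = boundaryLine (conj η) (-β) := by
  have hξ' : conj ξ ≠ 0 := (map_ne_zero _).2 hξ
  have hη' : conj η ≠ 0 := (map_ne_zero _).2 hη
  have hdomain : (∀ f ∈ (separatedExtension q w₁ w₂ ξ η α β).domain,
      parity (timeReversal f) ∈ (separatedExtension q w₁ w₂ ξ η α β).domain) ↔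
      boundaryLine ξ α = boundaryLine (conj η) (-β) := by
    simp only [hw.parity_mem_separatedExtension_domain_iff hq,
      hw.timeReversal_mem_separatedExtension_domain_iff]
    refine (hw.separatedExtension_domain_le_iff hξ hη hη' hξ').trans ?_
    rw [← boundaryLine_eq_conj_neg_comm hξ hη, and_self]
  rw [← hdomain]
  refine ⟨fun h f hf => (h.comm ⟨f, hf⟩).1, fun h =>
    ⟨hw.isClosedDense_separatedExtension hξ hη α β, fun f => ⟨h f f.2, ?_⟩⟩⟩
  have hTf := (hw.parity_mem_separatedExtension_domain_iff hq).1 (h f f.2)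
  exact ((separatedExtension_parity hq (f := ⟨_, hTf⟩) rfl).trans
    (congrArg parity (separatedExtension_timeReversal rfl))).symm

theorem isPSelfAdjoint_separatedExtension_iff (hq : Function.Even q) (hξ : ξ ≠ 0) (hη : η ≠ 0) :
    IsPSelfAdjoint (separatedExtension q w₁ w₂ ξ η α β) ↔
      boundaryLine ξ α = boundaryLine (conj η) (-β) := by
  have hξ' : conj ξ ≠ 0 := (map_ne_zero _).2 hξ
  have hη' : conj η ≠ 0 := (map_ne_zero _).2 hη
  have hadj := hw.adjoint_separatedExtension hξ hη α β
  have hparity (f : L2) : parity f ∈ (separatedExtension q w₁ w₂ ξ η α β).adjoint.domain ↔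
      f ∈ (separatedExtension q w₁ w₂ (conj η) (conj ξ) (-β) (-α)).domain := by
    rw [hadj, hw.parity_mem_separatedExtension_domain_iff hq]
  constructor
  · intro h
    exact ((hw.separatedExtension_domain_le_iff hξ hη hη' hξ').1
      fun f hf => (hparity f).1 ((h.mem_domain_iff f).1 hf)).1
  · intro h
    have heq := (hw.separatedExtension_eq_iff hξ hη hη' hξ').2
      ⟨h, (boundaryLine_eq_conj_neg_comm hξ hη).1 h⟩
    refine ⟨hw.isClosedDense_separatedExtension hξ hη α β, fun f => ?_, ?_⟩
    · rw [hparity, ← heq]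
    · rw [hadj]
      exact fun f hPf => separatedExtension_parity hq (f := ⟨_, hPf⟩) (parity_parity _).symm

theorem isPTSymmetric_and_isSelfAdjoint_and_isPSelfAdjoint_iff (hq : Function.Even q)
    (hξ : ‖ξ‖ = 1) (hη : ‖η‖ = 1)
    (hnα : IsNormalized ξ α) (hnβ : IsNormalized η β) :
    (IsPTSymmetric (separatedExtension q w₁ w₂ ξ η α β) ∧
      IsSelfAdjoint (separatedExtension q w₁ w₂ ξ η α β) ∧
      IsPSelfAdjoint (separatedExtension q w₁ w₂ ξ η α β)) ↔
      ξ = 1 ∧ η = 1 ∧ ∃ k : ℤ, α + β = k * Real.pi := by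
  have hξ₀ : ξ ≠ 0 := norm_ne_zero_iff.1 (hξ ▸ one_ne_zero)
  have hη₀ : η ≠ 0 := norm_ne_zero_iff.1 (hη ▸ one_ne_zero)
  rw [hw.isPTSymmetric_separatedExtension_iff hq hξ₀ hη₀,
    hw.isSelfAdjoint_separatedExtension_iff hξ₀ hη₀,
    hw.isPSelfAdjoint_separatedExtension_iff hq hξ₀ hη₀,
    boundaryLine_conj_eq_iff_of_isNormalized hξ hnα,
    boundaryLine_conj_eq_iff_of_isNormalized hη hnβ, ← boundaryLine_one_eq_one_neg_iff]
  constructor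
  · rintro ⟨h, ⟨rfl, rfl⟩, -⟩
    rw [map_one] at h
    exact ⟨rfl, rfl, h⟩
  · rintro ⟨rfl, rfl, h⟩
    rw [map_one]
    exact ⟨h, ⟨rfl, rfl⟩, h⟩

end IsFundamentalPair

end PTQM

theorem mainTheorem10
    (q : ℝ → ℝ) (hq : MeasureTheory.LocallyIntegrable q MeasureTheory.volume)
    (hq_even : Function.Even q)
    (hq_top : PTQM.LimitCircleTop q) (hq_bot : PTQM.LimitCircleBot q)
    (w₁ w₂ : ℝ → ℂ) (hw : PTQM.IsFundamentalPair q w₁ w₂)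
    (ξ η : ℂ) (hξ : ‖ξ‖ = 1) (hη : ‖η‖ = 1)
    (α β : ℝ) (hα : α ∈ Set.Ico 0 (2 * Real.pi)) (hβ : β ∈ Set.Ico 0 (2 * Real.pi)) :
    -- every separated boundary condition has normalized parameters
    (∃ (ξ' η' : ℂ) (α' β' : ℝ), ‖ξ'‖ = 1 ∧ ‖η'‖ = 1 ∧
      α' ∈ Set.Ico 0 (2 * Real.pi) ∧ β' ∈ Set.Ico 0 (2 * Real.pi) ∧
      PTQM.IsNormalized ξ' α' ∧ PTQM.IsNormalized η' β' ∧
      PTQM.separatedExtension q w₁ w₂ ξ η α β = PTQM.separatedExtension q w₁ w₂ ξ' η' α' β') ∧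
    -- the criterion in terms of normalized parameters
    (PTQM.IsNormalized ξ α → PTQM.IsNormalized η β →
      ((PTQM.IsPTSymmetric (PTQM.separatedExtension q w₁ w₂ ξ η α β) ∧
        IsSelfAdjoint (PTQM.separatedExtension q w₁ w₂ ξ η α β) ∧
        PTQM.IsPSelfAdjoint (PTQM.separatedExtension q w₁ w₂ ξ η α β)) ↔
        ξ = 1 ∧ η = 1 ∧ ∃ k : ℤ, α + β = k * Real.pi)) ∧
    -- the criterion for arbitrary parameters
    ((PTQM.IsPTSymmetric (PTQM.separatedExtension q w₁ w₂ ξ η α β) ∧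
        IsSelfAdjoint (PTQM.separatedExtension q w₁ w₂ ξ η α β) ∧
        PTQM.IsPSelfAdjoint (PTQM.separatedExtension q w₁ w₂ ξ η α β)) ↔
      ∃ α' ∈ Set.Ico 0 (2 * Real.pi), ∃ β' ∈ Set.Ico 0 (2 * Real.pi),
        (∃ k : ℤ, α' + β' = k * Real.pi) ∧
        PTQM.separatedExtension q w₁ w₂ ξ η α β = PTQM.separatedExtension q w₁ w₂ 1 1 α' β') := by
  obtain ⟨ξ', α', hξ', hα', hnα, hαα'⟩ := PTQM.exists_isNormalized hξ hα
  obtain ⟨η', β', hη', hβ', hnβ, hββ'⟩ := PTQM.exists_isNormalized hη hβ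
  have hne {ζ : ℂ} (hζ : ‖ζ‖ = 1) : ζ ≠ 0 := norm_ne_zero_iff.1 (hζ ▸ one_ne_zero)
  have heq := (hw.separatedExtension_eq_iff (hne hξ) (hne hη) (hne hξ') (hne hη')).2 ⟨hαα', hββ'⟩
  have hiff {ξ η : ℂ} {α β : ℝ} :=
    hw.isPTSymmetric_and_isSelfAdjoint_and_isPSelfAdjoint_iff (ξ := ξ) (η := η) (α := α) (β := β)
      hq_even
  refine ⟨⟨ξ', η', α', β', hξ', hη', hα', hβ', hnα, hnβ, heq⟩,
    hiff hξ hη, ⟨fun h => ?_, ?_⟩⟩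
  · obtain ⟨rfl, rfl, hk⟩ := (hiff hξ' hη' hnα hnβ).1 (heq ▸ h)
    exact ⟨α', hα', β', hβ', hk, heq⟩
  · rintro ⟨α'', -, β'', -, hk, h⟩
    rw [h]
    exact (hiff norm_one norm_one (PTQM.isNormalized_one α'') (PTQM.isNormalized_one β'')).2
      ⟨rfl, rfl, hk⟩
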